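/- Let $\mathcal H$ be a complex Hilbert space and let $V\subseteq\mathcal H$ be a standard subspace, i.e. a closed real subspace with $V\cap iV=\{0\}$ and $V+iV$ dense in $\mathcal H$. Let $T\colon V+iV\to\mathcal H$, $T(x+iy)=x-iy$ $(x,y\in V)$, be its Tomita operator, and let $(\Delta,J)$ be the modular objects of $V$, given by the polar decomposition $T=J\Delta^{1/2}$; thus $\Delta=T^*T$ is an injective positive selfadjoint operator and $J$ is an antiunitary involution. For $\zeta\in\mathcal H$ let $\alpha^\zeta\colon\mathbb R\to\mathcal H$, $\alpha^\zeta(t)=\Delta^{-it/2\pi}\zeta$, be its orbit map. Then for every $\xi\in\mathcal H$ the following are equivalent: (i) $\xi\in V$. (ii) $\xi\in\mathcal D(\Delta^{1/2})$ and $\Delta^{1/2}\xi=J\xi$. (iii) The orbit map $\alpha^\xi$ extends to a continuous map $\{z\in\mathbb C: 0\le \operatorname{Im} z\le\pi\}\to\mathcal H$ that is holomorphic on $\{0<\operatorname{Im} z<\pi\}$ and satisfies $\alpha^\xi(\pi i)=J\xi$. (iv) There is an $\eta\in\mathcal H$ with $J\eta=\eta$ whose orbit map $\alpha^\eta$ extends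 to a continuous map $\{z\in\mathbb C: |\operatorname{Im} z|\le\pi/2\}\to\mathcal H$ that is holomorphic on $\{|\operatorname{Im} z|<\pi/2\}$ and satisfies $\alpha^\eta(-\pi i/2)=\xi$. -/

import Mathlib

open Complex

namespace StandardSubspace

section Tomita

variable {H : Type*} [NormedAddCommGroup H] [InnerProductSpace ℂ H]

/-- Multiplication by `c` in terms of real and imaginary parts. -/
theorem smul_decomp (c : ℂ) (x y : H) :
    c • (x + I • y) = (c.re • x - c.im • y) + I • (c.im • x + c.re • y) := by
  simp only [← coe_smul]
  match_scalars <;> apply Complex.ext <;> simp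

/-- The domain `V + iV` of the Tomita operator, as a complex subspace of `H`. -/
def tomitaDomain (V : StandardSubspace H) : Submodule ℂ H where
  carrier := {z | ∃ x ∈ V.toClosedSubmodule.toSubmodule,
    ∃ y ∈ V.toClosedSubmodule.toSubmodule, z = x + I • y}
  zero_mem' := ⟨0, zero_mem _, 0, zero_mem _, by simp⟩
  add_mem' := by
    rintro _ _ ⟨x, hx, y, hy, rfl⟩ ⟨x', hx', y', hy', rfl⟩
    exact ⟨x + x', add_mem hx hx', y + y', add_mem hy hy', by rw [smul_add]; abel⟩
  smul_mem' := by
    rintro c _ ⟨x, hx, y, hy, rfl⟩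
    exact ⟨c.re • x - c.im • y, sub_mem (Submodule.smul_mem _ _ hx) (Submodule.smul_mem _ _ hy),
      c.im • x + c.re • y, add_mem (Submodule.smul_mem _ _ hx) (Submodule.smul_mem _ _ hy),
      smul_decomp c x y⟩

theorem mem_tomitaDomain (V : StandardSubspace H) {z : H} :
    z ∈ V.tomitaDomain ↔ ∃ x ∈ V.toClosedSubmodule.toSubmodule,
      ∃ y ∈ V.toClosedSubmodule.toSubmodule, z = x + I • y := Iff.rfl

/-- Because `V ∩ iV = 0`, the decomposition `z = x + iy` with `x, y ∈ V` is unique. -/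
theorem decomp_unique (V : StandardSubspace H) {x y x' y' : H}
    (hx : x ∈ V.toClosedSubmodule.toSubmodule) (hy : y ∈ V.toClosedSubmodule.toSubmodule)
    (hx' : x' ∈ V.toClosedSubmodule.toSubmodule) (hy' : y' ∈ V.toClosedSubmodule.toSubmodule)
    (h : x + I • y = x' + I • y') : x = x' ∧ y = y' := by
  have h1 : x - x' = I • (y' - y) := by
    rw [smul_sub, sub_eq_sub_iff_add_eq_add, h, add_comm]
  have hm : x - x' ∈ V.toClosedSubmodule ⊓ V.toClosedSubmodule.mulI := by
    refine ⟨sub_mem hx hx', ?_⟩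
    refine (ClosedSubmodule.mem_mapEquiv_iff (scalarSMulCLE H UnitI) _ _).2 ?_
    rw [scalarSMulCLE_symm_apply, h1, ← val_UnitI, ← Units.smul_def, inv_smul_smul]
    exact sub_mem (S := Submodule ℝ H) hy' hy
  rw [V.IsSeparating] at hm
  have h2 : x - x' = 0 := by simpa using hm
  refine ⟨sub_eq_zero.1 h2, ?_⟩
  rw [h2] at h1
  have h3 := (smul_eq_zero.1 h1.symm).resolve_left I_ne_zero
  exact (sub_eq_zero.1 h3).symm

/-- Every element of `V + iV` has a unique image under `x + iy ↦ x - iy`. -/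
theorem exists_tomita_value (V : StandardSubspace H) (z : V.tomitaDomain) :
    ∃ u : H, ∀ x ∈ V.toClosedSubmodule.toSubmodule, ∀ y ∈ V.toClosedSubmodule.toSubmodule,
      (z : H) = x + I • y → u = x - I • y := by
  obtain ⟨x, hx, y, hy, h⟩ := V.mem_tomitaDomain.1 z.2
  refine ⟨x - I • y, fun x' hx' y' hy' h' => ?_⟩
  obtain ⟨rfl, rfl⟩ := V.decomp_unique hx hy hx' hy' (h.symm.trans h')
  rfl

/-- The underlying function of the Tomita operator, `x + iy ↦ x - iy`. -/
noncomputable def tomitaFun (V : StandardSubspace H) (z : V.tomitaDomain) : H :=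
  (V.exists_tomita_value z).choose

theorem tomitaFun_eq (V : StandardSubspace H) (z : V.tomitaDomain) {x y : H}
    (hx : x ∈ V.toClosedSubmodule.toSubmodule) (hy : y ∈ V.toClosedSubmodule.toSubmodule)
    (h : (z : H) = x + I • y) : V.tomitaFun z = x - I • y :=
  (V.exists_tomita_value z).choose_spec x hx y hy h

/-- The Tomita operator `T : V + iV → H`, `T (x + iy) = x - iy` for `x, y ∈ V`, as an antilinear
map on its domain. -/
noncomputable def tomita (V : StandardSubspace H) : V.tomitaDomain →ₗ⋆[ℂ] H where
  toFun := V.tomitaFun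
  map_add' := by
    intro z z'
    obtain ⟨x, hx, y, hy, h⟩ := V.mem_tomitaDomain.1 z.2
    obtain ⟨x', hx', y', hy', h'⟩ := V.mem_tomitaDomain.1 z'.2
    rw [V.tomitaFun_eq z hx hy h, V.tomitaFun_eq z' hx' hy' h',
      V.tomitaFun_eq (z + z') (add_mem hx hx') (add_mem hy hy')
        (by rw [Submodule.coe_add, h, h', smul_add]; abel), smul_add]
    abel
  map_smul' := by
    intro c z
    obtain ⟨x, hx, y, hy, h⟩ := V.mem_tomitaDomain.1 z.2
    rw [V.tomitaFun_eq z hx hy h, V.tomitaFun_eq (c • z)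
      (sub_mem (Submodule.smul_mem _ c.re hx) (Submodule.smul_mem _ c.im hy))
      (add_mem (Submodule.smul_mem _ c.im hx) (Submodule.smul_mem _ c.re hy))
      (by rw [Submodule.coe_smul, h, smul_decomp])]
    simp only [← coe_smul]
    match_scalars <;> apply Complex.ext <;> simp

/-- The graph of `T* T`, where `T` is the Tomita operator and `T*` its antilinear adjoint
(`⟪T* y, w⟫ = ⟪T w, y⟫` for `w ∈ D(T)`): a pair `(x, z)` belongs to it if and only if
`x ∈ D(T)`, `T x ∈ D(T*)` and `T* (T x) = z`, that is, `⟪T w, T x⟫ = ⟪z, w⟫` for all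
`w ∈ D(T)`. -/
def modularGraph (V : StandardSubspace H) : Submodule ℂ (H × H) where
  carrier := {p | ∃ hx : p.1 ∈ V.tomitaDomain, ∀ w : V.tomitaDomain,
    inner ℂ (V.tomita w) (V.tomita ⟨p.1, hx⟩) = inner ℂ p.2 (w : H)}
  zero_mem' := by
    refine ⟨V.tomitaDomain.zero_mem, fun w => ?_⟩
    have h0 : V.tomita ⟨(0 : H × H).1, V.tomitaDomain.zero_mem⟩ = 0 := V.tomita.map_zero
    rw [h0]
    simp
  add_mem' := by
    rintro p q ⟨hp, hp'⟩ ⟨hq, hq'⟩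
    refine ⟨V.tomitaDomain.add_mem hp hq, fun w => ?_⟩
    have h0 : V.tomita ⟨(p + q).1, V.tomitaDomain.add_mem hp hq⟩ =
        V.tomita ⟨p.1, hp⟩ + V.tomita ⟨q.1, hq⟩ := V.tomita.map_add ⟨p.1, hp⟩ ⟨q.1, hq⟩
    rw [h0, inner_add_right, hp', hq', Prod.snd_add, inner_add_left]
  smul_mem' := by
    rintro c p ⟨hp, hp'⟩
    refine ⟨V.tomitaDomain.smul_mem c hp, fun w => ?_⟩
    have h0 : V.tomita ⟨(c • p).1, V.tomitaDomain.smul_mem c hp⟩ =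
        (starRingEnd ℂ) c • V.tomita ⟨p.1, hp⟩ := V.tomita.map_smulₛₗ c ⟨p.1, hp⟩
    rw [h0, inner_smul_right, hp', Prod.smul_snd, inner_smul_left]

/-- The modular operator `Δ = T* T` of `V`, an unbounded operator on `H`. -/
noncomputable def modularOperator (V : StandardSubspace H) : H →ₗ.[ℂ] H :=
  V.modularGraph.toLinearPMap

end Tomita

end StandardSubspace

section ComplexPowers

variable {H : Type*} [NormedAddCommGroup H] [InnerProductSpace ℂ H] [CompleteSpace H]

open Classical in
/-- The bounded operator `(1 + A)⁻¹ : H → D(A)`. It exists and is unique if `A` is a positive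
selfadjoint operator; the value is `0` if `1 + A` has no bounded everywhere defined
right inverse. -/
noncomputable def oneAddInv (A : H →ₗ.[ℂ] H) : H →L[ℂ] H :=
  if h : ∃ B : H →L[ℂ] H, ∀ x : H, ∃ hx : B x ∈ A.domain, B x + A ⟨B x, hx⟩ = x
  then h.choose else 0

/-- The function `x ↦ (x (1 - x)) ^ n * ((1 - x) / x) ^ z`, which is continuous on `[0, 1]`
for `n > |Re z|`. Under the substitution `x = 1 / (1 + t)` with `0 < t < ∞` it is
`(t / (1 + t) ^ 2) ^ n * t ^ z`. -/
noncomputable def regularizedPower (n : ℕ) (z x : ℂ) : ℂ :=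
  (x * (1 - x)) ^ n * ((1 - x) / x) ^ z

/-- The complex power `A ^ z` of an injective positive selfadjoint operator `A`, with its natural
(maximal) domain, given by the functional calculus: `A ^ z = e(A)⁻¹ (e · f)(A)`, where
`f(t) = t ^ z`, and `e(t) = (t / (1 + t) ^ 2) ^ n` with `n > |Re z|` is a regularizer, so that
`e` and `e · f` are bounded and continuous on `[0, ∞)`, and `e(A)` is injective. As functions of
the bounded selfadjoint operator `B = (1 + A)⁻¹`, whose spectrum lies in `[0, 1]`, one has
`e(A) = (B (1 - B)) ^ n`, and `(e · f)(A)` is given by the continuous functional calculus of `B`.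
So `ξ ∈ D(A ^ z)` with `A ^ z ξ = ζ` if and only if `(e · f)(A) ξ = e(A) ζ`; in terms of the
spectral measure `P` of `A`, this is the operator `∫ t ^ z dP(t)` with domain
`{ξ | ∫ |t ^ z| ^ 2 d⟪ξ, P(t) ξ⟫ < ∞}`. -/
noncomputable def operatorPower (A : H →ₗ.[ℂ] H) (z : ℂ) : H →ₗ.[ℂ] H :=
  (LinearMap.ker
    (((cfc (regularizedPower (⌊|z.re|⌋₊ + 1) z) (oneAddInv A) : H →L[ℂ] H) : H →ₗ[ℂ] H) ∘ₗ
        LinearMap.fst ℂ H H -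
      (((oneAddInv A * (1 - oneAddInv A)) ^ (⌊|z.re|⌋₊ + 1) : H →L[ℂ] H) : H →ₗ[ℂ] H) ∘ₗ
        LinearMap.snd ℂ H H)).toLinearPMap

/-- `F` is an extension of the orbit map `t ↦ A ^ (-it/2π) ξ`, `t ∈ ℝ`, to the closed strip
`{a ≤ Im z ≤ b}` that is continuous on the closed strip and holomorphic on its interior. -/
structure IsOrbitExtension (A : H →ₗ.[ℂ] H) (ξ : H) (a b : ℝ) (F : ℂ → H) : Prop where
  continuousOn : ContinuousOn F {z : ℂ | a ≤ z.im ∧ z.im ≤ b}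
  differentiableOn : DifferentiableOn ℂ F {z : ℂ | a < z.im ∧ z.im < b}
  eq_orbit : ∀ t : ℝ, ∃ h : ξ ∈ (operatorPower A (-(I * t) / (2 * Real.pi))).domain,
    F t = operatorPower A (-(I * t) / (2 * Real.pi)) ⟨ξ, h⟩

/-- The modular conjugation `J` of `V`, the antilinear part of the polar decomposition
`T = J Δ ^ (1/2)` of the Tomita operator: it is the continuous antilinear extension to `H` of the
isometric map `Δ ^ (1/2) x ↦ T x`, `x ∈ D(T) = D(Δ ^ (1/2))`, whose domain is dense. -/
noncomputable def StandardSubspace.modularConjugation (V : StandardSubspace H) : H →L⋆[ℂ] H :=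
  (V.tomita ∘ₛₗ (Submodule.inclusion
      (inf_le_left : V.tomitaDomain ⊓ (operatorPower V.modularOperator (1 / 2)).domain ≤ _))
    ).extendOfNorm
    ((operatorPower V.modularOperator (1 / 2)).toFun ∘ₗ (Submodule.inclusion
      (inf_le_right : V.tomitaDomain ⊓ (operatorPower V.modularOperator (1 / 2)).domain ≤ _)))

end ComplexPowers

/-! The proof trades the unbounded `Δ` for the bounded operator `B = (1 + Δ)⁻¹`. Let `P` and `Q` be
the real orthogonal projections onto `V` and `iV`. Then `B = (P + Q)/2`
(`oneAddInv_modularOperator`), while `D = (P - Q)/2` is antilinear, with `D² = B(1 - B)` and `DB =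
(1 - B)D`. As `P = B + D`, a vector `ξ` lies in `V` iff `Dξ = (1 - B)ξ`.

The polar decomposition `D = J (B(1 - B))^(1/2)` yields the modular conjugation
(`modularConjugation_eq`), which exchanges `B` and `1 - B`. Cancelling `J` turns the criterion into
`(B(1 - B))^(1/2) ξ = BJξ`. Since `Δ = (1 - B)/B`, this is `Δ^(1/2) ξ = Jξ`, so (i) ⇔ (ii).

For (iii) and (iv), `V` is the image under `B^(1/2)` of the `J`-fixed vectors `u`
(`exists_fixed_of_mem`). On `ξ = B^(1/2) u` the power `Δ^w` acts as `B^(1/2 - w) (1 - B)^w u`, a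
contraction for `0 ≤ Re w ≤ 1/2`; with `w = -iz/2π` this gives the extensions. Conversely, an
extension multiplied by `B(1 - B)` agrees on the real line with `B^(1 - w) (1 - B)^(1 + w) ξ`, hence
on the whole strip (`modPow_one_one_orbitExtension`); its boundary value gives back the criterion
for `V`. -/

/-! ### Uniqueness of holomorphic extension from a boundary line -/

open Metric Set in
-- The maximum principle suffices, without reflection. The square centred at `c` with half side `Im
-- c` has its bottom side on the real line. In the product of `f` with its rotations about `c` by
-- multiples of a right angle, some factor vanishes on each side, and the value at the centre is
-- `f(c)^4`.
theorem eq_zero_of_vanishes_below_square {f : ℂ → ℂ} {b : ℝ}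
    (hc : ContinuousOn f {z : ℂ | 0 ≤ z.im ∧ z.im ≤ b})
    (hd : DifferentiableOn ℂ f {z : ℂ | 0 < z.im ∧ z.im < b}) (h0 : ∀ t : ℝ, f t = 0)
    {c : ℂ} (hc0 : 0 < c.im) (hcb : 2 * c.im < b) : f c = 0 := by
  set r := c.im with hr
  set U : Set ℂ := Ioo (-r) r ×ℂ Ioo (-r) r with hU
  have hrr : (-r) ≠ r := by linarith
  have hcl : closure U = Icc (-r) r ×ℂ Icc (-r) r := by
    rw [hU, closure_reProdIm, closure_Ioo hrr]
  have hbd : Bornology.IsBounded U := isBounded_Ioo (-r) r |>.reProdIm (isBounded_Ioo (-r) r)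
  have key : ∀ u : ℂ, (u = 1 ∨ u = I ∨ u = -1 ∨ u = -I) →
      DiffContOnCl ℂ (fun z => f (c + u * z)) U := by
    intro u hu
    refine ⟨hd.comp (by fun_prop) ?_, hc.comp (by fun_prop) ?_⟩
    · rintro z ⟨⟨h1, h2⟩, ⟨h3, h4⟩⟩
      rcases hu with rfl | rfl | rfl | rfl <;> simp <;> constructor <;> linarith
    · rw [hcl]
      rintro z ⟨⟨h1, h2⟩, ⟨h3, h4⟩⟩
      rcases hu with rfl | rfl | rfl | rfl <;> simp <;> constructor <;> linarith
  have hreal : ∀ z : ℂ, z.im = 0 → f z = 0 := fun z hz => by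
    rw [← h0 z.re]; congr 1; apply Complex.ext <;> simp [hz]
  set g : ℂ → ℂ := fun z => (f (c + 1 * z) * f (c + I * z)) * (f (c + (-1) * z) * f (c + (-I) * z))
  have hg : DiffContOnCl ℂ g U := by
    have h1 := key 1 (by simp)
    have h2 := key I (by simp)
    have h3 := key (-1) (by simp)
    have h4 := key (-I) (by simp)
    exact ⟨(h1.1.mul h2.1).mul (h3.1.mul h4.1), (h1.2.mul h2.2).mul (h3.2.mul h4.2)⟩
  have hfr : ∀ z ∈ frontier U, ‖g z‖ ≤ 0 := by
    intro z hz
    rw [hU, frontier_reProdIm, closure_Ioo hrr, frontier_Ioo (by linarith)] at hz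
    have : g z = 0 := by
      rcases hz with ⟨-, h⟩ | ⟨h, -⟩ <;> rcases h with h | h
      · have : f (c + 1 * z) = 0 := hreal _ (by simp at h ⊢; linarith)
        simp only [g, this]; ring
      · have : f (c + (-1) * z) = 0 := hreal _ (by simp at h ⊢; linarith)
        simp only [g, this]; ring
      · have : f (c + I * z) = 0 := hreal _ (by simp at h ⊢; linarith)
        simp only [g, this]; ring
      · have : f (c + (-I) * z) = 0 := hreal _ (by simp at h ⊢; linarith)
        simp only [g, this]; ring
    simp [this]
  have h0cl : (0 : ℂ) ∈ closure U := by
    rw [hcl]; constructor <;> simp <;> linarith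
  have := norm_le_of_forall_mem_frontier_norm_le hbd hg hfr h0cl
  have h4 : f c * f c * (f c * f c) = 0 := by simpa [g] using norm_le_zero_iff.1 this
  simpa using h4

/-- A function that is continuous on a closed strip, holomorphic inside, and zero on one of the
two boundary lines is zero. -/
theorem eq_zero_on_strip_of_eq_zero_on_real {f : ℂ → ℂ} {b : ℝ} (hb : 0 < b)
    (hc : ContinuousOn f {z : ℂ | 0 ≤ z.im ∧ z.im ≤ b})
    (hd : DifferentiableOn ℂ f {z : ℂ | 0 < z.im ∧ z.im < b}) (h0 : ∀ t : ℝ, f t = 0)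
    {z : ℂ} (hz0 : 0 ≤ z.im) (hzb : z.im ≤ b) : f z = 0 := by
  have hpre : {z : ℂ | 0 < z.im ∧ z.im < b} = Complex.im ⁻¹' Set.Ioo 0 b := rfl
  have hopen : IsOpen {z : ℂ | 0 < z.im ∧ z.im < b} := by
    rw [hpre]; exact isOpen_Ioo.preimage continuous_im
  have hconv : Convex ℝ {z : ℂ | 0 < z.im ∧ z.im < b} := by
    rw [hpre]; exact (convex_Ioo 0 b).linear_preimage imLm
  have han := hd.analyticOnNhd hopen
  set c : ℂ := (b / 4 : ℝ) * I with hcdef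
  have hcim : c.im = b / 4 := by simp [hcdef]
  have hin : Set.EqOn f 0 {z : ℂ | 0 < z.im ∧ z.im < b} := by
    refine han.eqOn_zero_of_preconnected_of_eventuallyEq_zero hconv.isPreconnected (z₀ := c) ?_ ?_
    · simp [hcdef]; constructor <;> linarith
    · have : im ⁻¹' Set.Ioo 0 (b / 2) ∈ nhds c :=
        (isOpen_Ioo.preimage continuous_im).mem_nhds (by simp [hcim]; constructor <;> linarith)
      filter_upwards [this] with w hw
      exact eq_zero_of_vanishes_below_square hc hd h0 hw.1 (by linarith [hw.2])
  refine hin.of_subset_closure hc continuousOn_const (fun w hw => ⟨hw.1.le, hw.2.le⟩) ?_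
    (show z ∈ {z : ℂ | 0 ≤ z.im ∧ z.im ≤ b} from ⟨hz0, hzb⟩)
  rw [hpre, closure_preimage_im, closure_Ioo hb.ne]
  exact fun w hw => hw

theorem eq_on_strip_of_eq_on_real {E : Type*} [NormedAddCommGroup E] [InnerProductSpace ℂ E]
    {f g : ℂ → E} {b : ℝ} (hb : 0 < b)
    (hfc : ContinuousOn f {z : ℂ | 0 ≤ z.im ∧ z.im ≤ b})
    (hfd : DifferentiableOn ℂ f {z : ℂ | 0 < z.im ∧ z.im < b})
    (hgc : ContinuousOn g {z : ℂ | 0 ≤ z.im ∧ z.im ≤ b})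
    (hgd : DifferentiableOn ℂ g {z : ℂ | 0 < z.im ∧ z.im < b}) (h0 : ∀ t : ℝ, f t = g t)
    {z : ℂ} (hz0 : 0 ≤ z.im) (hzb : z.im ≤ b) : f z = g z := by
  refine ext_inner_left ℂ fun v => sub_eq_zero.1 ?_
  refine eq_zero_on_strip_of_eq_zero_on_real
    (f := fun z => innerSL ℂ v (f z) - innerSL ℂ v (g z)) hb ?_ ?_ ?_ hz0 hzb
  · exact ((innerSL ℂ v).continuous.comp_continuousOn hfc).sub
      ((innerSL ℂ v).continuous.comp_continuousOn hgc)
  · exact ((innerSL ℂ v).differentiable.comp_differentiableOn hfd).sub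
      ((innerSL ℂ v).differentiable.comp_differentiableOn hgd)
  · intro t; simp [h0]

theorem eq_on_lower_strip_of_eq_on_real {E : Type*} [NormedAddCommGroup E] [InnerProductSpace ℂ E]
    {f g : ℂ → E} {b : ℝ} (hb : 0 < b)
    (hfc : ContinuousOn f {z : ℂ | -b ≤ z.im ∧ z.im ≤ 0})
    (hfd : DifferentiableOn ℂ f {z : ℂ | -b < z.im ∧ z.im < 0})
    (hgc : ContinuousOn g {z : ℂ | -b ≤ z.im ∧ z.im ≤ 0})
    (hgd : DifferentiableOn ℂ g {z : ℂ | -b < z.im ∧ z.im < 0}) (h0 : ∀ t : ℝ, f t = g t)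
    {z : ℂ} (hz0 : -b ≤ z.im) (hzb : z.im ≤ 0) : f z = g z := by
  have h1 : Set.MapsTo (fun z : ℂ => -z) {z : ℂ | 0 ≤ z.im ∧ z.im ≤ b}
      {z : ℂ | -b ≤ z.im ∧ z.im ≤ 0} := fun z hz => by
    simp only [Set.mem_ofPred_eq, neg_im] at hz ⊢; constructor <;> linarith
  have h2 : Set.MapsTo (fun z : ℂ => -z) {z : ℂ | 0 < z.im ∧ z.im < b}
      {z : ℂ | -b < z.im ∧ z.im < 0} := fun z hz => by
    simp only [Set.mem_ofPred_eq, neg_im] at hz ⊢; constructor <;> linarith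
  have := eq_on_strip_of_eq_on_real (f := fun z => f (-z)) (g := fun z => g (-z)) hb
    (hfc.comp (by fun_prop) h1) (hfd.comp (by fun_prop) h2) (hgc.comp (by fun_prop) h1)
    (hgd.comp (by fun_prop) h2) (fun t => by simpa using h0 (-t)) (z := -z)
    (by simpa using hzb) (by simp; linarith)
  simpa using this

/-! ### Holomorphic parameters in the functional calculus -/

open Metric Set Function in
/-- The continuous functional calculus depends holomorphically on parameters. -/
theorem differentiableOn_cfc_of_param {A : Type*} [CStarAlgebra A] (a : A) (ha : IsStarNormal a)
    {U : Set ℂ} (hU : IsOpen U) (g : ℂ → ℂ → ℂ)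
    (hg : ContinuousOn (uncurry g) (U ×ˢ spectrum ℂ a))
    (hd : ∀ x ∈ spectrum ℂ a, DifferentiableOn ℂ (fun w => g w x) U) :
    DifferentiableOn ℂ (fun w => cfc (g w) a) U := by
  have hK : IsCompact (spectrum ℂ a) := spectrum.isCompact a
  have hgw : ∀ w ∈ U, ContinuousOn (g w) (spectrum ℂ a) := fun w hw =>
    hg.comp (by fun_prop : ContinuousOn (fun x => (w, x)) _) fun x hx => ⟨hw, hx⟩
  have hcont : ContinuousOn (fun w => cfc (g w) a) U := by
    intro w hw
    refine continuousWithinAt_cfc_fun ?_ (eventually_mem_nhdsWithin.mono hgw)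
    refine Metric.tendstoUniformlyOn_iff.2 fun ε hε => ?_
    obtain ⟨v, hv, h⟩ := hK.mem_uniformity_of_prod hg hw (dist_mem_uniformity hε)
    filter_upwards [hv] with p hp x hx
    rw [dist_comm]
    exact h p hp x hx
  intro w hw
  obtain ⟨R, hR, hRU⟩ := nhds_basis_closedBall.mem_iff.1 (hU.mem_nhds hw)
  have hsph : sphere w R ⊆ U := sphere_subset_closedBall.trans hRU
  -- Cauchy's formula for each `g · x` passes through the functional calculus, which commutes with
  -- the integral. A Cauchy integral of a continuous function is analytic.
  have key : ∀ v ∈ ball w R,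
      (2 * Real.pi * I : ℂ)⁻¹ • (∮ z in C(w, R), (z - v)⁻¹ • cfc (g z) a) = cfc (g v) a := by
    intro v hv
    have hne : ∀ θ, circleMap w R θ - v ≠ 0 := fun θ h => by
      have h1 := circleMap_mem_sphere w hR.le θ
      rw [sub_eq_zero.1 h] at h1
      exact absurd (mem_ball.1 hv) (by rw [mem_sphere.1 h1]; exact lt_irrefl _)
    set F : ℝ → ℂ → ℂ := fun θ x =>
      deriv (circleMap w R) θ * ((circleMap w R θ - v)⁻¹ * g (circleMap w R θ) x) with hF
    have hFc : ContinuousOn (uncurry F) (univ ×ˢ spectrum ℂ a) := by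
      have h1 : ContinuousOn (fun p : ℝ × ℂ => g (circleMap w R p.1) p.2)
          (univ ×ˢ spectrum ℂ a) :=
        hg.comp (f := fun p : ℝ × ℂ => (circleMap w R p.1, p.2))
          (by fun_prop) fun p hp => ⟨hsph (circleMap_mem_sphere w hR.le _), hp.2⟩
      have h2 : Continuous fun p : ℝ × ℂ => (circleMap w R p.1 - v)⁻¹ :=
        Continuous.inv₀ (by fun_prop) fun p => hne p.1
      have h3 : Continuous fun p : ℝ × ℂ => deriv (circleMap w R) p.1 := by
        simp only [deriv_circleMap]; fun_prop
      exact h3.continuousOn.mul (h2.continuousOn.mul h1)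
    obtain ⟨C, hC⟩ := (isCompact_Icc (a := (0 : ℝ)) (b := 2 * Real.pi)).prod hK
      |>.exists_bound_of_continuousOn (hFc.mono (prod_mono_left (subset_univ _)))
    have h1 := cfc_setIntegral (μ := MeasureTheory.volume) (s := Ioc 0 (2 * Real.pi))
      measurableSet_Ioc F (fun _ => C) a (hFc.mono (prod_mono_left (subset_univ _)))
      (by
        refine MeasureTheory.ae_restrict_of_forall_mem measurableSet_Ioc fun θ hθ x hx => ?_
        exact hC (θ, x) ⟨Ioc_subset_Icc_self hθ, hx⟩)
      (MeasureTheory.integrable_const C).2 ha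
    have h2 : ∀ x ∈ spectrum ℂ a,
        ∫ θ in Ioc 0 (2 * Real.pi), F θ x = (2 * Real.pi * I : ℂ) • g v x := by
      intro x hx
      rw [← intervalIntegral.integral_of_le Real.two_pi_pos.le]
      have hdx := hd x hx
      rw [← DiffContOnCl.circleIntegral_sub_inv_smul (f := fun w => g w x) (c := w) (R := R)
        ⟨hdx.mono (ball_subset_closedBall.trans hRU), hdx.continuousOn.mono
          (closure_ball_subset_closedBall.trans hRU)⟩ hv]
      simp only [circleIntegral, hF, smul_eq_mul]
    have h3 : ∀ θ, cfc (F θ) a = deriv (circleMap w R) θ •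
        ((circleMap w R θ - v)⁻¹ • cfc (g (circleMap w R θ)) a) := by
      intro θ
      have hc := hgw _ (hsph (circleMap_mem_sphere w hR.le θ))
      rw [← cfc_smul _ _ a hc, ← cfc_smul _ (fun x => (circleMap w R θ - v)⁻¹ • g _ x) a
        (hc.fun_const_smul _)]
      rfl
    have h4 : (∮ z in C(w, R), (z - v)⁻¹ • cfc (g z) a) = (2 * Real.pi * I : ℂ) • cfc (g v) a := by
      rw [← cfc_smul _ _ a (hgw v (hRU (ball_subset_closedBall hv))), ← cfc_congr h2, h1,
        circleIntegral, intervalIntegral.integral_of_le Real.two_pi_pos.le]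
      simp only [h3]
    rw [h4, inv_smul_smul₀]
    simp [Real.pi_ne_zero]
  lift R to NNReal using hR.le
  have hps := hasFPowerSeriesOn_cauchy_integral
    ((hcont.mono hsph).circleIntegrable R.coe_nonneg) (by exact_mod_cast hR)
  have hda := hps.differentiableOn.differentiableAt (x := w)
    (Metric.isOpen_eball.mem_nhds (by simpa using hR))
  refine (hda.congr_of_eventuallyEq ?_).differentiableWithinAt
  filter_upwards [ball_mem_nhds w hR] with v hv using (key v hv).symm

/-! ### Real projections and the resolvent of the modular operator -/

namespace StandardSubspace

section Projection

variable {H : Type*} [NormedAddCommGroup H] [InnerProductSpace ℂ H]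

theorem eq_zero_of_mem_of_I_smul_mem (V : StandardSubspace H) {x : H}
    (hx : x ∈ V.toClosedSubmodule.toSubmodule) (hIx : I • x ∈ V.toClosedSubmodule.toSubmodule) :
    x = 0 := by
  have h := (V.decomp_unique hx (zero_mem _) (zero_mem _) (neg_mem hIx)
    (by rw [smul_neg, smul_smul, I_mul_I]; simp)).1
  exact h

theorem dense_tomitaDomain (V : StandardSubspace H) : Dense (V.tomitaDomain : Set H) := by
  intro z
  have hz : z ∈ V.toClosedSubmodule ⊔ V.toClosedSubmodule.mulI := by rw [V.IsCyclic]; trivial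
  rw [ClosedSubmodule.mem_sup] at hz
  refine closure_mono ?_ hz
  intro w hw
  obtain ⟨x, hx, y, hy, rfl⟩ := Submodule.mem_sup.1 hw
  have hy' := (ClosedSubmodule.mem_mapEquiv_iff (scalarSMulCLE H UnitI) V.toClosedSubmodule y).1 hy
  refine ⟨x, hx, _, hy', ?_⟩
  rw [scalarSMulCLE_symm_apply, ← val_UnitI, ← Units.smul_def, smul_inv_smul]

open ClosedSubmodule in
theorem exists_projection [CompleteSpace H] (V : StandardSubspace H) : ∃ P : H →L[ℝ] H,
    (∀ x, P x ∈ V.toClosedSubmodule.toSubmodule) ∧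
    (∀ x ∈ V.toClosedSubmodule.toSubmodule, P x = x) ∧
    (∀ x y, (inner ℂ (P x) y).re = (inner ℂ x (P y)).re) := by
  set K : Submodule ℝ H := V.toClosedSubmodule.toSubmodule
  have : CompleteSpace K := V.toClosedSubmodule.isClosed.completeSpace_coe
  refine ⟨K.starProjection, fun x => K.starProjection_apply_mem x,
    fun x hx => K.starProjection_eq_self_iff.2 hx, fun x y => ?_⟩
  exact K.inner_starProjection_left_eq_right x y

/-- The real orthogonal projection onto a standard subspace. -/
noncomputable def proj [CompleteSpace H] (V : StandardSubspace H) : H →L[ℝ] H :=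
  V.exists_projection.choose

theorem re_inner_self (x : H) : (inner ℂ x x).re = ‖x‖ ^ 2 := by
  rw [inner_self_eq_norm_sq_to_K]; norm_cast

theorem I_smul_I_smul (x : H) : I • I • x = -x := by
  rw [smul_smul, I_mul_I, neg_one_smul]

theorem re_inner_I_smul_left (x y : H) : (inner ℂ (I • x) y).re = (inner ℂ x y).im := by
  rw [inner_smul_left]; simp

theorem re_inner_I_smul_right (x y : H) : (inner ℂ x (I • y)).re = -(inner ℂ x y).im := by
  rw [inner_smul_right]; simp

theorem re_inner_half_left (x y : H) :
    (inner ℂ ((1 / 2 : ℂ) • x) y).re = (inner ℂ x y).re / 2 := by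
  rw [inner_smul_left]; simp; ring

theorem re_inner_half_right (x y : H) :
    (inner ℂ x ((1 / 2 : ℂ) • y)).re = (inner ℂ x y).re / 2 := by
  rw [inner_smul_right]; simp; ring

theorem tomita_apply_of_eq (V : StandardSubspace H) {z : H} (hz : z ∈ V.tomitaDomain) {x y : H}
    (hx : x ∈ V.toClosedSubmodule.toSubmodule) (hy : y ∈ V.toClosedSubmodule.toSubmodule)
    (h : z = x + I • y) : V.tomita ⟨z, hz⟩ = x - I • y :=
  V.tomitaFun_eq ⟨z, hz⟩ hx hy h

theorem modularGraph_single_valued (V : StandardSubspace H) (p : H × H) (hp : p ∈ V.modularGraph) (h0 : p.1 = 0) :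
    p.2 = 0 := by
  obtain ⟨hx, h⟩ := hp
  refine V.dense_tomitaDomain.eq_zero_of_inner_left ℂ fun w hw => ?_
  have h1 : (⟨p.1, hx⟩ : V.tomitaDomain) = 0 := Subtype.ext h0
  rw [← h ⟨w, hw⟩, h1, map_zero, inner_zero_right]

theorem mem_graph_modularOperator (V : StandardSubspace H) {p : H × H} :
    p ∈ V.modularOperator.graph ↔ p ∈ V.modularGraph := by
  rw [modularOperator, Submodule.toLinearPMap_graph_eq _ V.modularGraph_single_valued]

variable [CompleteSpace H] (V : StandardSubspace H)

theorem proj_mem (x : H) : V.proj x ∈ V.toClosedSubmodule.toSubmodule :=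
  V.exists_projection.choose_spec.1 x

theorem proj_of_mem {x : H} (hx : x ∈ V.toClosedSubmodule.toSubmodule) : V.proj x = x :=
  V.exists_projection.choose_spec.2.1 x hx

theorem proj_proj (x : H) : V.proj (V.proj x) = V.proj x := V.proj_of_mem (V.proj_mem x)

theorem re_inner_proj (x y : H) : (inner ℂ (V.proj x) y).re = (inner ℂ x (V.proj y)).re :=
  V.exists_projection.choose_spec.2.2 x y

theorem proj_eq_self_iff {x : H} : V.proj x = x ↔ x ∈ V.toClosedSubmodule.toSubmodule :=
  ⟨fun h => h ▸ V.proj_mem x, V.proj_of_mem⟩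

theorem proj_smul (c : ℂ) (x : H) :
    V.proj (c • x) = (c.re : ℂ) • V.proj x + (c.im : ℂ) • V.proj (I • x) := by
  have h : c • x = c.re • x + c.im • (I • x) := by
    conv_lhs => rw [← re_add_im c, add_smul, mul_smul, coe_smul, coe_smul]
  rw [h, map_add, map_smul, map_smul, coe_smul, coe_smul]

theorem proj_I_smul_smul (c : ℂ) (x : H) :
    V.proj (I • c • x) = (c.re : ℂ) • V.proj (I • x) - (c.im : ℂ) • V.proj x := by
  have h : I • c • x = c.re • (I • x) - c.im • x := by
    simp only [← coe_smul]
    match_scalars; apply Complex.ext <;> simp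
  rw [h, map_sub, map_smul (V.proj) c.re, map_smul (V.proj) c.im, coe_smul, coe_smul]

/-- The arithmetic mean of the real orthogonal projections onto `V` and `iV`. -/
noncomputable def meanProj : H →L[ℂ] H where
  toFun x := (1 / 2 : ℂ) • (V.proj x - I • V.proj (I • x))
  map_add' x y := by simp only [smul_add, map_add]; module
  map_smul' c x := by
    rw [proj_smul, proj_I_smul_smul, RingHom.id_apply]
    match_scalars <;> apply Complex.ext <;> simp [mul_comm]
  cont := by fun_prop

/-- Half the difference of the real orthogonal projections onto `V` and `iV`. -/
noncomputable def diffProj : H →L⋆[ℂ] H where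
  toFun x := (1 / 2 : ℂ) • (V.proj x + I • V.proj (I • x))
  map_add' x y := by simp only [smul_add, map_add]; module
  map_smul' c x := by
    rw [proj_smul, proj_I_smul_smul]
    match_scalars <;> apply Complex.ext <;> simp [mul_comm]
  cont := by fun_prop

theorem meanProj_apply (x : H) :
    V.meanProj x = (1 / 2 : ℂ) • (V.proj x - I • V.proj (I • x)) := rfl

theorem diffProj_apply (x : H) :
    V.diffProj x = (1 / 2 : ℂ) • (V.proj x + I • V.proj (I • x)) := rfl

theorem proj_half_smul (x : H) : V.proj ((1 / 2 : ℂ) • x) = (1 / 2 : ℂ) • V.proj x := by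
  have h : ∀ y : H, (1 / 2 : ℂ) • y = (1 / 2 : ℝ) • y := fun y => by
    rw [← coe_smul]; norm_num
  rw [h, h, map_smul]

/-- Both sides are `(P + Q - PQ - QP)/4`, where `Q = -iPi` is the projection onto `iV`. -/
theorem diffProj_diffProj (x : H) :
    V.diffProj (V.diffProj x) = V.meanProj x - V.meanProj (V.meanProj x) := by
  simp only [meanProj_apply, diffProj_apply]
  rw [smul_comm I (1 / 2 : ℂ), smul_comm I (1 / 2 : ℂ)]
  simp only [proj_half_smul, map_add, map_sub, smul_add, smul_sub, I_smul_I_smul, map_neg,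
    proj_proj]
  module

theorem diffProj_meanProj (x : H) :
    V.diffProj (V.meanProj x) = V.diffProj x - V.meanProj (V.diffProj x) := by
  simp only [meanProj_apply, diffProj_apply]
  rw [smul_comm I (1 / 2 : ℂ), smul_comm I (1 / 2 : ℂ)]
  simp only [proj_half_smul, map_add, map_sub, smul_add, smul_sub, I_smul_I_smul, map_neg,
    proj_proj]
  module

theorem meanProj_add_diffProj (x : H) : V.meanProj x + V.diffProj x = V.proj x := by
  rw [meanProj_apply, diffProj_apply]; module

/-- An element of `H` lies in `V` if and only if it is fixed by the real projection. -/
theorem mem_iff_diffProj_eq {x : H} :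
    x ∈ V.toClosedSubmodule.toSubmodule ↔ V.diffProj x = x - V.meanProj x := by
  rw [← proj_eq_self_iff, ← meanProj_add_diffProj, eq_sub_iff_add_eq, add_comm]

theorem im_inner_proj_I (x y : H) :
    (inner ℂ (V.proj (I • x)) y).im = -(inner ℂ x (V.proj (I • y))).im := by
  have := V.re_inner_proj (I • x) (I • y)
  rwa [re_inner_I_smul_left, re_inner_I_smul_right, neg_eq_iff_eq_neg] at this

theorem inner_meanProj (x y : H) : inner ℂ (V.meanProj x) y = inner ℂ x (V.meanProj y) := by
  have hre : ∀ x y : H, (inner ℂ (V.meanProj x) y).re = (inner ℂ x (V.meanProj y)).re := by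
    intro x y
    rw [meanProj_apply, meanProj_apply, re_inner_half_left, re_inner_half_right, inner_sub_left,
      inner_sub_right, sub_re, sub_re, re_inner_I_smul_left, re_inner_I_smul_right, re_inner_proj,
      im_inner_proj_I]
  apply Complex.ext (hre x y)
  -- The imaginary part is the real part at `i x`, as `meanProj` is complex linear.
  have := hre (I • x) y
  rwa [map_smul, re_inner_I_smul_left, re_inner_I_smul_left] at this

theorem inner_diffProj (x y : H) : inner ℂ (V.diffProj x) y = inner ℂ (V.diffProj y) x := by
  have hre : ∀ x y : H, (inner ℂ (V.diffProj x) y).re = (inner ℂ (V.diffProj y) x).re := by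
    intro x y
    rw [← inner_conj_symm (V.diffProj y) x, conj_re]
    rw [diffProj_apply, diffProj_apply, re_inner_half_left, re_inner_half_right, inner_add_left,
      inner_add_right, add_re, add_re, re_inner_I_smul_left, re_inner_I_smul_right, re_inner_proj,
      im_inner_proj_I]
  apply Complex.ext (hre x y)
  have := hre (I • x) y
  rw [map_smulₛₗ, conj_I, neg_smul, inner_neg_left, neg_re, re_inner_I_smul_left,
    re_inner_I_smul_right, neg_inj] at this
  exact this

theorem re_inner_meanProj_self (x : H) :
    (inner ℂ (V.meanProj x) x).re = (‖V.proj x‖ ^ 2 + ‖V.proj (I • x)‖ ^ 2) / 2 := by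
  have h : ∀ z : H, ‖V.proj z‖ ^ 2 = (inner ℂ (V.proj z) z).re := fun z => by
    rw [← V.proj_proj z, re_inner_proj, V.proj_proj, re_inner_self]
  rw [meanProj_apply, re_inner_half_left, inner_sub_left, sub_re, re_inner_I_smul_left, h, h,
    re_inner_I_smul_right]
  ring

theorem re_inner_sub_meanProj_self (x : H) :
    (inner ℂ (x - V.meanProj x) x).re =
      (‖x - V.proj x‖ ^ 2 + ‖I • x - V.proj (I • x)‖ ^ 2) / 2 := by
  have h : ∀ z : H, ‖z - V.proj z‖ ^ 2 = ‖z‖ ^ 2 - ‖V.proj z‖ ^ 2 := fun z => by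
    have h1 : (inner ℂ z (V.proj z)).re = ‖V.proj z‖ ^ 2 := by
      conv_lhs => rw [← V.proj_proj z, ← re_inner_proj, inner_self_eq_norm_sq_to_K]
      norm_cast
    rw [@norm_sub_sq ℂ]
    change ‖z‖ ^ 2 - 2 * (inner ℂ z (V.proj z)).re + _ = _
    rw [h1]; ring
  rw [inner_sub_left, sub_re, re_inner_meanProj_self, h, h, norm_smul, norm_I, one_mul,
    re_inner_self]
  ring

/-- A kernel vector is real orthogonal to `V` and to `iV`, hence orthogonal to the dense subspace `V
+ iV`. -/
theorem meanProj_injective : Function.Injective V.meanProj := by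
  refine (injective_iff_map_eq_zero _).2 fun x hx => ?_
  have h := V.re_inner_meanProj_self x
  rw [hx, inner_zero_left, zero_re] at h
  have h1 : V.proj x = 0 := by
    rw [← norm_eq_zero, ← sq_eq_zero_iff]
    linarith [sq_nonneg ‖V.proj x‖, sq_nonneg ‖V.proj (I • x)‖]
  have h2 : V.proj (I • x) = 0 := by
    rw [← norm_eq_zero, ← sq_eq_zero_iff]
    linarith [sq_nonneg ‖V.proj x‖, sq_nonneg ‖V.proj (I • x)‖]
  refine V.dense_tomitaDomain.eq_zero_of_inner_left ℂ fun w hw => ?_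
  have key : ∀ v ∈ V.toClosedSubmodule.toSubmodule, inner ℂ x v = 0 := fun v hv => by
    rw [← V.proj_of_mem hv]
    apply Complex.ext
    · rw [← re_inner_proj, h1]; simp
    · rw [← re_inner_I_smul_left, ← re_inner_proj, h2]; simp
  obtain ⟨p, hp, q, hq, h⟩ := hw
  rw [h, inner_add_right, inner_smul_right, key p hp, key q hq]
  simp

/-- A kernel vector is fixed by both real projections, so it lies in `V ∩ iV = {0}`. -/
theorem sub_meanProj_injective : Function.Injective (fun x => x - V.meanProj x) := by
  have : Function.Injective (1 - V.meanProj : H →L[ℂ] H) := by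
    refine (injective_iff_map_eq_zero _).2 fun x hx => ?_
    have h := V.re_inner_sub_meanProj_self x
    have hx' : x - V.meanProj x = 0 := hx
    rw [hx', inner_zero_left, zero_re] at h
    have h1 : x - V.proj x = 0 := by
      rw [← norm_eq_zero, ← sq_eq_zero_iff]
      linarith [sq_nonneg ‖x - V.proj x‖, sq_nonneg ‖I • x - V.proj (I • x)‖]
    have h2 : I • x - V.proj (I • x) = 0 := by
      rw [← norm_eq_zero, ← sq_eq_zero_iff]
      linarith [sq_nonneg ‖x - V.proj x‖, sq_nonneg ‖I • x - V.proj (I • x)‖]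
    exact V.eq_zero_of_mem_of_I_smul_mem (V.proj_eq_self_iff.1 (sub_eq_zero.1 h1).symm)
      (V.proj_eq_self_iff.1 (sub_eq_zero.1 h2).symm)
  exact this

theorem meanProj_nonneg : 0 ≤ V.meanProj := by
  rw [ContinuousLinearMap.nonneg_iff_isPositive]
  refine ⟨fun x y => V.inner_meanProj x y, fun x => ?_⟩
  change 0 ≤ (inner ℂ (V.meanProj x) x).re
  rw [re_inner_meanProj_self]; positivity

theorem meanProj_le_one : V.meanProj ≤ 1 := by
  rw [ContinuousLinearMap.le_def]
  refine ⟨fun x y => ?_, fun x => ?_⟩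
  · change inner ℂ (x - V.meanProj x) y = inner ℂ x (y - V.meanProj y)
    rw [inner_sub_left, inner_sub_right, inner_meanProj]
  · change 0 ≤ (inner ℂ (x - V.meanProj x) x).re
    rw [re_inner_sub_meanProj_self]; positivity

theorem meanProj_mem_tomitaDomain (x : H) : V.meanProj x ∈ V.tomitaDomain := by
  have hs : ∀ y : H, (1 / 2 : ℂ) • y = (1 / 2 : ℝ) • y := fun y => by
    rw [← coe_smul]; norm_num
  refine ⟨(1 / 2 : ℝ) • V.proj x, Submodule.smul_mem _ _ (V.proj_mem x),
    -((1 / 2 : ℝ) • V.proj (I • x)), neg_mem (Submodule.smul_mem _ _ (V.proj_mem _)), ?_⟩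
  rw [← hs, ← hs, meanProj_apply]; module

theorem tomita_meanProj (x : H) :
    V.tomita ⟨V.meanProj x, V.meanProj_mem_tomitaDomain x⟩ = V.diffProj x := by
  have hs : ∀ y : H, (1 / 2 : ℂ) • y = (1 / 2 : ℝ) • y := fun y => by
    rw [← coe_smul]; norm_num
  rw [V.tomita_apply_of_eq _ (x := (1 / 2 : ℝ) • V.proj x) (y := -((1 / 2 : ℝ) • V.proj (I • x)))
    (Submodule.smul_mem _ _ (V.proj_mem x)) (neg_mem (Submodule.smul_mem _ _ (V.proj_mem _)))]
  · rw [← hs, ← hs, diffProj_apply]; module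
  · rw [← hs, ← hs, meanProj_apply]; module

theorem inner_mem_diffProj {w : H} (hw : w ∈ V.toClosedSubmodule.toSubmodule) (x : H) :
    inner ℂ w (V.diffProj x) = inner ℂ (x - V.meanProj x) w := by
  rw [← inner_conj_symm, inner_diffProj, V.mem_iff_diffProj_eq.1 hw, inner_conj_symm,
    inner_sub_left, inner_sub_right, inner_meanProj]

/-- This is `ΔB = 1 - B` in weak form: `TB = D`, and pairing with `w ∈ V` uses `Dw = (1 - B)w`.
Antilinearity of `T` carries it to `V + iV`. -/
theorem meanProj_mem_modularGraph (x : H) :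
    (V.meanProj x, x - V.meanProj x) ∈ V.modularGraph := by
  refine ⟨V.meanProj_mem_tomitaDomain x, fun w => ?_⟩
  change inner ℂ (V.tomita w) (V.tomita ⟨V.meanProj x, V.meanProj_mem_tomitaDomain x⟩) =
    inner ℂ (x - V.meanProj x) (w : H)
  obtain ⟨w, hw⟩ := w
  obtain ⟨p, hp, q, hq, h⟩ := id hw
  rw [tomita_meanProj, V.tomita_apply_of_eq hw hp hq h, inner_sub_left, inner_smul_left,
    V.inner_mem_diffProj hp, V.inner_mem_diffProj hq, conj_I]
  change _ = inner ℂ (x - V.meanProj x) w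
  rw [h, inner_add_right, inner_smul_right]
  ring

/-- `oneAddInv` is some chosen right inverse, so uniqueness is needed. The difference `d` of two
candidates at `x` satisfies `Δd = -d`, whence `‖Td‖² = -‖d‖²` and `d = 0`. -/
theorem oneAddInv_modularOperator : oneAddInv V.modularOperator = V.meanProj := by
  have hex : ∃ B : H →L[ℂ] H, ∀ x : H, ∃ hx : B x ∈ V.modularOperator.domain,
      B x + V.modularOperator ⟨B x, hx⟩ = x := by
    refine ⟨V.meanProj, fun x => ?_⟩
    obtain ⟨y, hy1, hy2⟩ := LinearPMap.mem_graph_iff _ |>.1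
      (V.mem_graph_modularOperator.2 (V.meanProj_mem_modularGraph x))
    simp only at hy1 hy2
    refine ⟨hy1 ▸ y.2, ?_⟩
    have : (⟨V.meanProj x, hy1 ▸ y.2⟩ : V.modularOperator.domain) = y := Subtype.ext hy1.symm
    rw [this, hy2]; abel
  rw [oneAddInv, dif_pos hex]
  ext x
  obtain ⟨hx, h⟩ := hex.choose_spec x
  set b := hex.choose x
  have hg : (b, x - b) ∈ V.modularGraph := by
    rw [← mem_graph_modularOperator, LinearPMap.mem_graph_iff]
    exact ⟨⟨b, hx⟩, rfl, eq_sub_of_add_eq' h⟩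
  obtain ⟨hd, hd'⟩ := V.modularGraph.sub_mem hg (V.meanProj_mem_modularGraph x)
  have h1 := hd' ⟨_, hd⟩
  simp only [Prod.snd_sub, Prod.fst_sub] at h1
  have h2 : x - b - (x - V.meanProj x) = -(b - V.meanProj x) := by abel
  rw [h2, inner_neg_left, inner_self_eq_norm_sq_to_K, inner_self_eq_norm_sq_to_K] at h1
  norm_cast at h1
  have h3 : ‖b - V.meanProj x‖ ^ 2 = 0 :=
    le_antisymm (by rw [← neg_nonneg, ← h1]; positivity) (by positivity)
  exact sub_eq_zero.1 (norm_eq_zero.1 (pow_eq_zero_iff (by norm_num) |>.1 h3))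

end Projection

end StandardSubspace

/-! ### The scalar functions `x^a (1 - x)^b` on `[0, 1]` -/

section PowerProducts

/-- The function `x ↦ x ^ a * (1 - x) ^ b`. -/
noncomputable def powProd (a b x : ℂ) : ℂ := x ^ a * (1 - x) ^ b

/-- The exponents `a` for which `x ↦ x ^ a` is continuous on `[0, ∞)`. -/
def RegularExponent (a : ℂ) : Prop := a = 0 ∨ 0 < a.re

theorem RegularExponent.zero : RegularExponent 0 := Or.inl rfl

theorem RegularExponent.of_pos {a : ℂ} (h : 0 < a.re) : RegularExponent a := Or.inr h

theorem RegularExponent.ofReal {a : ℝ} (h : 0 ≤ a) : RegularExponent a := by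
  rcases h.eq_or_lt with rfl | h
  · exact Or.inl ofReal_zero
  · exact Or.inr (by simpa using h)

/-- At `x = 0` additivity could fail only through `0 ^ 0 = 1`; two regular exponents never cancel to
`0` unless both are `0`. -/
theorem cpow_add_of_regular {a b : ℂ} (ha : RegularExponent a) (hb : RegularExponent b) (x : ℂ) :
    x ^ (a + b) = x ^ a * x ^ b := by
  rcases ha with rfl | ha
  · simp
  rcases hb with rfl | hb
  · simp
  rcases eq_or_ne x 0 with rfl | hx
  · have h1 : a ≠ 0 := fun h => by simp [h] at ha
    have h2 : a + b ≠ 0 := fun h => by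
      have := congrArg re h
      rw [add_re, zero_re] at this
      linarith
    rw [zero_cpow h1, zero_cpow h2, zero_mul]
  · exact cpow_add _ _ hx

theorem powProd_mul {a b c d : ℂ} (ha : RegularExponent a) (hb : RegularExponent b)
    (hc : RegularExponent c) (hd : RegularExponent d) (x : ℂ) :
    powProd a b x * powProd c d x = powProd (a + c) (b + d) x := by
  rw [powProd, powProd, powProd, cpow_add_of_regular ha hc, cpow_add_of_regular hb hd]
  ring

theorem continuousAt_cpow_of_regular {a : ℂ} (ha : RegularExponent a) {x : ℂ} (hx : 0 ≤ x.re) :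
    ContinuousAt (fun x : ℂ => x ^ a) x := by
  rcases ha with rfl | ha
  · simp only [cpow_zero]; exact continuousAt_const
  · exact ContinuousAt.comp (f := fun x : ℂ => (x, a)) (x := x)
      (continuousAt_cpow_of_re_pos (p := (x, a)) (Or.inl hx) ha) (by fun_prop)

theorem continuousAt_powProd {a b : ℂ} (ha : RegularExponent a) (hb : RegularExponent b) {x : ℂ}
    (hx0 : 0 ≤ x.re) (hx1 : x.re ≤ 1) : ContinuousAt (powProd a b) x := by
  refine (continuousAt_cpow_of_regular ha hx0).mul ?_
  exact ContinuousAt.comp (g := fun x : ℂ => x ^ b) (f := fun x : ℂ => 1 - x)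
    (continuousAt_cpow_of_regular hb (by simpa using hx1)) (by fun_prop)

theorem powProd_ofReal (a b : ℝ) {r : ℝ} (h0 : 0 ≤ r) (h1 : r ≤ 1) :
    powProd a b r = ((r ^ a * (1 - r) ^ b : ℝ) : ℂ) := by
  rw [powProd, ofReal_mul, ofReal_cpow h0, ofReal_cpow (sub_nonneg.2 h1)]
  push_cast
  rfl

theorem conj_cpow_of_nonneg (a : ℂ) {r : ℝ} (h0 : 0 ≤ r) :
    (starRingEnd ℂ) ((r : ℂ) ^ a) = (r : ℂ) ^ (starRingEnd ℂ a) := by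
  rw [cpow_conj _ _ (by rw [arg_ofReal_of_nonneg h0]; exact Real.pi_ne_zero.symm), conj_ofReal]

theorem conj_powProd (a b : ℂ) {r : ℝ} (h0 : 0 ≤ r) (h1 : r ≤ 1) :
    (starRingEnd ℂ) (powProd a b r) = powProd (starRingEnd ℂ a) (starRingEnd ℂ b) r := by
  have h : (1 : ℂ) - r = ((1 - r : ℝ) : ℂ) := by push_cast; rfl
  rw [powProd, powProd, map_mul, conj_cpow_of_nonneg a h0, h,
    conj_cpow_of_nonneg b (sub_nonneg.2 h1)]

theorem norm_powProd {a b : ℂ} (ha : 0 < a.re) (hb : 0 < b.re) {r : ℝ} (h0 : 0 ≤ r)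
    (h1 : r ≤ 1) : ‖powProd a b r‖ = r ^ a.re * (1 - r) ^ b.re := by
  have h : (1 : ℂ) - r = ((1 - r : ℝ) : ℂ) := by push_cast; rfl
  rw [powProd, norm_mul, norm_cpow_eq_rpow_re_of_nonneg h0 ha.ne', h,
    norm_cpow_eq_rpow_re_of_nonneg (sub_nonneg.2 h1) hb.ne']

end PowerProducts

/-! ### The operators `B^a (1 - B)^b` for `0 ≤ B ≤ 1` -/

section FunctionalCalculus

variable {H : Type*} [NormedAddCommGroup H] [InnerProductSpace ℂ H] [CompleteSpace H]

theorem exists_real_of_mem_spectrum {B : H →L[ℂ] H} (h0 : 0 ≤ B) (h1 : B ≤ 1) {x : ℂ}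
    (hx : x ∈ spectrum ℂ B) : ∃ r : ℝ, 0 ≤ r ∧ r ≤ 1 ∧ x = r := by
  have hsa : IsSelfAdjoint B := .of_nonneg h0
  have hxr : x = (x.re : ℂ) := hsa.mem_spectrum_eq_re hx
  have hr : x.re ∈ spectrum ℝ B := by
    rw [← spectrum.algebraMap_mem_iff ℂ]; rwa [hxr] at hx
  refine ⟨x.re, spectrum_nonneg_of_nonneg h0 hr, ?_, hxr⟩
  have h2 : 1 - x.re ∈ spectrum ℝ (1 - B) := by
    have := spectrum.singleton_sub_eq B (1 : ℝ)
    rw [map_one] at this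
    rw [← this]
    exact Set.sub_mem_sub rfl hr
  linarith [spectrum_nonneg_of_nonneg (sub_nonneg.2 h1) h2]

open ComplexOrder in
/-- If `|f| ≤ |g|` on the spectrum then `f(B)` is dominated by `g(B)` vector by vector. -/
theorem norm_cfc_apply_le {B : H →L[ℂ] H} (_hB : IsStarNormal B) {f g : ℂ → ℂ}
    (hf : ContinuousOn f (spectrum ℂ B)) (hg : ContinuousOn g (spectrum ℂ B))
    (h : ∀ x ∈ spectrum ℂ B, ‖f x‖ ≤ ‖g x‖) (v : H) : ‖cfc f B v‖ ≤ ‖cfc g B v‖ := by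
  -- Squared norms become quadratic forms of `|k|²(B)`, which are compared by monotonicity of the
  -- calculus.
  have key : ∀ k : ℂ → ℂ, ContinuousOn k (spectrum ℂ B) →
      ‖cfc k B v‖ ^ 2 = (inner ℂ (cfc (fun x => star (k x) * k x) B v) v).re := by
    intro k hk
    rw [cfc_mul (fun x => star (k x)) k B hk.star hk, cfc_star, mul_apply_eq_comp,
      ContinuousLinearMap.star_eq_adjoint, ContinuousLinearMap.adjoint_inner_left,
      inner_self_eq_norm_sq_to_K]
    norm_cast
  have hle : cfc (fun x => star (f x) * f x) B ≤ cfc (fun x => star (g x) * g x) B := by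
    refine cfc_mono (fun x hx => ?_) (hf.star.mul hf) (hg.star.mul hg)
    have hn : ∀ z : ℂ, star z * z = ((‖z‖ ^ 2 : ℝ) : ℂ) := fun z => by
      rw [Complex.star_def, conj_mul']; push_cast; rfl
    rw [hn, hn, real_le_real]
    exact pow_le_pow_left₀ (norm_nonneg _) (h x hx) 2
  have hpos := (ContinuousLinearMap.le_def _ _).1 hle |>.2 v
  refine le_of_sq_le_sq ?_ (norm_nonneg _)
  rw [key f hf, key g hg]
  have h2 : 0 ≤ (inner ℂ ((cfc (fun x => star (g x) * g x) B -
    cfc (fun x => star (f x) * f x) B) v) v).re := hpos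
  rw [sub_apply, inner_sub_left, sub_re] at h2
  linarith

/-- The operator `B ^ a (1 - B) ^ b`. -/
noncomputable def opPowProd (B : H →L[ℂ] H) (a b : ℂ) : H →L[ℂ] H := cfc (powProd a b) B

variable {B : H →L[ℂ] H} (h0 : 0 ≤ B) (h1 : B ≤ 1)
include h0 h1

theorem continuousOn_powProd_spectrum {a b : ℂ} (ha : RegularExponent a) (hb : RegularExponent b) :
    ContinuousOn (powProd a b) (spectrum ℂ B) := by
  intro x hx
  obtain ⟨r, hr0, hr1, rfl⟩ := exists_real_of_mem_spectrum h0 h1 hx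
  exact (continuousAt_powProd ha hb (by simpa using hr0) (by simpa using hr1)).continuousWithinAt

theorem opPowProd_mul {a b c d : ℂ} (ha : RegularExponent a) (hb : RegularExponent b)
    (hc : RegularExponent c) (hd : RegularExponent d) :
    opPowProd B a b * opPowProd B c d = opPowProd B (a + c) (b + d) := by
  rw [opPowProd, opPowProd, ← cfc_mul _ _ B (continuousOn_powProd_spectrum h0 h1 ha hb)
    (continuousOn_powProd_spectrum h0 h1 hc hd), opPowProd]
  exact cfc_congr fun x _ => powProd_mul ha hb hc hd x

theorem opPowProd_apply_apply {a b c d : ℂ} (ha : RegularExponent a) (hb : RegularExponent b)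
    (hc : RegularExponent c) (hd : RegularExponent d) (v : H) :
    opPowProd B a b (opPowProd B c d v) = opPowProd B (a + c) (b + d) v := by
  rw [← opPowProd_mul h0 h1 ha hb hc hd, mul_apply_eq_comp]

theorem adjoint_opPowProd (a b : ℂ) :
    (opPowProd B a b).adjoint = opPowProd B (starRingEnd ℂ a) (starRingEnd ℂ b) := by
  rw [← ContinuousLinearMap.star_eq_adjoint, opPowProd, ← cfc_star]
  refine cfc_congr fun x hx => ?_
  obtain ⟨r, hr0, hr1, rfl⟩ := exists_real_of_mem_spectrum h0 h1 hx
  exact conj_powProd a b hr0 hr1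

theorem inner_opPowProd_ofReal (a b : ℝ) (v w : H) :
    inner ℂ (opPowProd B a b v) w = inner ℂ v (opPowProd B a b w) := by
  rw [← ContinuousLinearMap.adjoint_inner_left, adjoint_opPowProd h0 h1, conj_ofReal, conj_ofReal]

omit h1 in
theorem isStarNormal_of_nonneg : IsStarNormal B := (IsSelfAdjoint.of_nonneg h0).isStarNormal

omit h1 in
theorem opPowProd_one_zero : opPowProd B 1 0 = B := by
  have := isStarNormal_of_nonneg h0
  have h : powProd 1 0 = id := by ext x; simp [powProd]
  rw [opPowProd, h, cfc_id ℂ B]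

omit h1 in
theorem opPowProd_zero_one : opPowProd B 0 1 = 1 - B := by
  have := isStarNormal_of_nonneg h0
  have h : powProd 0 1 = fun x => 1 - x := by ext x; simp [powProd]
  rw [opPowProd, h, cfc_sub (fun _ => (1 : ℂ)) (fun x => x) B, cfc_const_one ℂ B, cfc_id' ℂ B]

theorem opPowProd_one_one : opPowProd B 1 1 = B * (1 - B) := by
  have hz := RegularExponent.zero
  have ho : RegularExponent 1 := .of_pos (by simp)
  have h := opPowProd_mul h0 h1 ho hz hz ho
  rw [opPowProd_one_zero h0, opPowProd_zero_one h0, add_zero, zero_add] at h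
  exact h.symm

theorem norm_opPowProd_apply_le {a b : ℂ} (ha : 1 ≤ a.re) (hb : 1 ≤ b.re) (v : H) :
    ‖opPowProd B a b v‖ ≤ ‖opPowProd B 1 1 v‖ := by
  have ho : RegularExponent 1 := .of_pos (by simp)
  refine norm_cfc_apply_le (isStarNormal_of_nonneg h0)
    (continuousOn_powProd_spectrum h0 h1 (.of_pos (by linarith)) (.of_pos (by linarith)))
    (continuousOn_powProd_spectrum h0 h1 ho ho) (fun x hx => ?_) v
  obtain ⟨r, hr0, hr1, rfl⟩ := exists_real_of_mem_spectrum h0 h1 hx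
  rw [norm_powProd (by linarith) (by linarith) hr0 hr1, norm_powProd (by simp) (by simp) hr0 hr1]
  have key : ∀ s t : ℝ, 0 ≤ s → s ≤ 1 → 1 ≤ t → s ^ t ≤ s ^ (1 : ℝ) := fun s t hs0 hs1 ht =>
    Real.rpow_le_rpow_of_exponent_ge' hs0 hs1 zero_le_one ht
  exact mul_le_mul (key _ _ hr0 hr1 ha) (key _ _ (by linarith) (by linarith) hb)
    (Real.rpow_nonneg (by linarith) _) (Real.rpow_nonneg hr0 _)

theorem differentiableOn_opPowProd (a b : ℂ) :
    DifferentiableOn ℂ (fun w => opPowProd B (a - w) (b + w)) {w | -b.re < w.re ∧ w.re < a.re} := by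
  refine differentiableOn_cfc_of_param B (isStarNormal_of_nonneg h0) ?_ _ ?_ ?_
  · exact (isOpen_lt continuous_const continuous_re).inter (isOpen_lt continuous_re continuous_const)
  · rintro ⟨w, x⟩ ⟨⟨hw1, hw2⟩, hx⟩
    obtain ⟨r, hr0, hr1, rfl⟩ := exists_real_of_mem_spectrum h0 h1 hx
    refine ContinuousAt.continuousWithinAt ?_
    refine ContinuousAt.mul ?_ ?_
    · exact ContinuousAt.comp (g := fun p : ℂ × ℂ => p.1 ^ p.2) (f := fun p : ℂ × ℂ => (p.2, a - p.1))
        (continuousAt_cpow_of_re_pos (Or.inl (by simpa using hr0)) (by simpa using hw2))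
        (by fun_prop)
    · exact ContinuousAt.comp (g := fun p : ℂ × ℂ => p.1 ^ p.2)
        (f := fun p : ℂ × ℂ => (1 - p.2, b + p.1))
        (continuousAt_cpow_of_re_pos (Or.inl (by simpa using hr1))
          (by simp; linarith)) (by fun_prop)
  · intro x _ w hw
    have ha : a - w ≠ 0 := fun h => by
      have := congrArg re h
      rw [sub_re, zero_re] at this
      linarith [hw.2]
    have hb : b + w ≠ 0 := fun h => by
      have := congrArg re h
      rw [add_re, zero_re] at this
      linarith [hw.1]
    refine DifferentiableAt.differentiableWithinAt ?_
    exact ((differentiableAt_id.const_sub a).const_cpow (Or.inr ha)).mul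
      ((differentiableAt_id.const_add b).const_cpow (Or.inr hb))

-- The coefficients are real because `S` conjugates scalars; each factor `B` becomes `1 - B` on
-- passing through `S`.
omit h0 h1 [CompleteSpace H] in
theorem antilinear_aeval {S : H →L⋆[ℂ] H} (hS : ∀ v, S (B v) = S v - B (S v))
    (p : Polynomial ℝ) (v : H) :
    S (Polynomial.aeval B (p.map ofRealHom) v) =
      Polynomial.aeval B ((p.comp (1 - Polynomial.X)).map ofRealHom) (S v) := by
  induction p using Polynomial.induction_on' with
  | add p q hp hq =>
    simp only [Polynomial.map_add, Polynomial.add_comp, map_add, add_apply,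
      hp, hq]
  | monomial n c =>
    have hpow : ∀ n : ℕ, S ((B ^ n) v) = ((1 - B) ^ n) (S v) := by
      intro n
      induction n with
      | zero => simp
      | succ n ih =>
        rw [pow_succ', pow_succ', mul_apply_eq_comp, mul_apply_eq_comp, hS,
          ih]
        rfl
    have hsmul : ∀ u : H, S ((c : ℂ) • u) = (c : ℂ) • S u := fun u => by
      rw [map_smulₛₗ, conj_ofReal]
    simpa [← Polynomial.C_mul_X_pow_eq_monomial, Algebra.algebraMap_eq_smul_one] using
      (hsmul ((B ^ n) v)).trans (congrArg _ (hpow n))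

theorem norm_aeval_sub_opPowProd_le {a b : ℝ} (ha : 0 ≤ a) (hb : 0 ≤ b) {p : Polynomial ℝ}
    {ε : ℝ} (hε : 0 ≤ ε) (hp : ∀ r ∈ Set.Icc (0 : ℝ) 1, |p.eval r - r ^ a * (1 - r) ^ b| ≤ ε) :
    ‖Polynomial.aeval B (p.map ofRealHom) - opPowProd B a b‖ ≤ ε := by
  have := isStarNormal_of_nonneg h0
  rw [← cfc_polynomial (p.map ofRealHom) B, opPowProd, ← cfc_sub _ _ B
    (Polynomial.continuous _).continuousOn
    (continuousOn_powProd_spectrum h0 h1 (.ofReal ha) (.ofReal hb))]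
  refine norm_cfc_le hε fun x hx => ?_
  obtain ⟨r, hr0, hr1, rfl⟩ := exists_real_of_mem_spectrum h0 h1 hx
  have h2 : (p.map ofRealHom).eval (r : ℂ) = ((p.eval r : ℝ) : ℂ) :=
    Polynomial.eval_map_apply ofRealHom r
  rw [h2, powProd_ofReal a b hr0 hr1, ← ofReal_sub, norm_real, Real.norm_eq_abs]
  exact hp r ⟨hr0, hr1⟩

/-- An antilinear operator that intertwines `B` and `1 - B` intertwines their functional calculi. -/
theorem antilinear_opPowProd {S : H →L⋆[ℂ] H} (hS : ∀ v, S (B v) = S v - B (S v))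
    {a b : ℝ} (ha : 0 ≤ a) (hb : 0 ≤ b) (v : H) :
    S (opPowProd B a b v) = opPowProd B b a (S v) := by
  refine eq_of_forall_dist_le fun δ hδ => ?_
  obtain ⟨ε, hε, hεδ⟩ : ∃ ε > 0, (‖S‖ * ‖v‖ * 2) * ε ≤ δ := by
    obtain ⟨ε, hε, h⟩ := exists_pos_mul_lt hδ (‖S‖ * ‖v‖ * 2)
    exact ⟨ε, hε, h.le⟩
  have hcont : Continuous fun r : ℝ => r ^ a * (1 - r) ^ b :=
    (Real.continuous_rpow_const ha).mul
      ((Real.continuous_rpow_const hb).comp (continuous_const.sub continuous_id))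
  -- Weierstrass approximation; `p(1 - r)` approximates the function with `a` and `b` exchanged,
  -- with the same error.
  obtain ⟨p, hp⟩ := exists_polynomial_near_of_continuousOn 0 1 _ hcont.continuousOn ε hε
  have hA := norm_aeval_sub_opPowProd_le h0 h1 ha hb hε.le fun r hr => (hp r hr).le
  have hA' := norm_aeval_sub_opPowProd_le h0 h1 (p := p.comp (1 - Polynomial.X)) hb ha hε.le
    fun r hr => by
      have := hp (1 - r) ⟨by linarith [hr.2], by linarith [hr.1]⟩
      rw [sub_sub_cancel, mul_comm] at this
      simpa [Polynomial.eval_comp] using this.le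
  set A := Polynomial.aeval B (p.map ofRealHom)
  set A' := Polynomial.aeval B ((p.comp (1 - Polynomial.X)).map ofRealHom)
  have hAA : S (A v) = A' (S v) := antilinear_aeval hS p v
  have e1 : ‖S (A v - opPowProd B a b v)‖ ≤ ‖S‖ * (ε * ‖v‖) :=
    (S.le_opNorm _).trans <| by
      gcongr
      exact (A - opPowProd B a b).le_of_opNorm_le hA v
  have e2 : ‖A' (S v) - opPowProd B b a (S v)‖ ≤ ε * (‖S‖ * ‖v‖) :=
    ((A' - opPowProd B b a).le_of_opNorm_le hA' (S v)).trans <| by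
      gcongr; exact S.le_opNorm v
  have e3 : S (opPowProd B a b v) - opPowProd B b a (S v) =
      (A' (S v) - opPowProd B b a (S v)) - S (A v - opPowProd B a b v) := by
    rw [map_sub, hAA]; abel
  rw [dist_eq_norm, e3]
  calc _ ≤ ε * (‖S‖ * ‖v‖) + ‖S‖ * (ε * ‖v‖) := (norm_sub_le _ _).trans (add_le_add e2 e1)
    _ = (‖S‖ * ‖v‖ * 2) * ε := by ring
    _ ≤ δ := hεδ

omit h0 h1 in
theorem denseRange_of_symmetric_injective {C : H →L[ℂ] H}
    (hC : ∀ v w, inner ℂ (C v) w = inner ℂ v (C w)) (hi : Function.Injective C) :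
    DenseRange C := by
  have h : (LinearMap.range C.toLinearMap)ᗮ = ⊥ := by
    rw [Submodule.eq_bot_iff]
    intro x hx
    refine hi ((ext_inner_left ℂ fun v => ?_).trans (map_zero C).symm)
    rw [← hC, inner_zero_right]
    exact (Submodule.mem_orthogonal _ _).1 hx _ ⟨v, rfl⟩
  have := (Submodule.dense_iff_topologicalClosure_eq_top).2
    ((Submodule.topologicalClosure_eq_top_iff).2 h)
  exact this

end FunctionalCalculus

/-- At `r = 0` and `r = 1` both sides vanish, as `1 - z` and `1 + z` are nonzero; in between, the
power of the quotient of positive reals splits. -/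
theorem regularizedPower_one_eq_powProd {z : ℂ} (hz : |z.re| < 1) {r : ℝ} (h0 : 0 ≤ r)
    (h1 : r ≤ 1) : regularizedPower 1 z r = powProd (1 - z) (1 + z) r := by
  obtain ⟨hz1, hz2⟩ := abs_lt.1 hz
  have ha : 1 - z ≠ 0 := fun h => by
    have := congrArg re h; rw [sub_re, one_re, zero_re] at this; linarith
  have hb : 1 + z ≠ 0 := fun h => by
    have := congrArg re h; rw [add_re, one_re, zero_re] at this; linarith
  rw [regularizedPower, powProd, pow_one]
  rcases h0.eq_or_lt with rfl | h0
  · simp [zero_cpow ha]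
  rcases h1.eq_or_lt with rfl | h1
  · simp [zero_cpow hb]
  have hr : (r : ℂ) ≠ 0 := ofReal_ne_zero.2 h0.ne'
  have hr1 : (1 : ℂ) - r ≠ 0 := by
    rw [← ofReal_one, ← ofReal_sub]; exact ofReal_ne_zero.2 (sub_pos.2 h1).ne'
  have hdiv : ((1 - r) / r : ℂ) ^ z = (1 - r : ℂ) ^ z * ((r : ℂ) ^ z)⁻¹ := by
    have := mul_cpow_ofReal_nonneg (sub_pos.2 h1).le (inv_pos.2 h0).le z
    rw [div_eq_mul_inv, ← inv_cpow _ _ (by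
      rw [arg_ofReal_of_nonneg h0.le]; exact Real.pi_ne_zero.symm)]
    push_cast at this
    exact this
  rw [hdiv, cpow_sub _ _ hr, cpow_add _ _ hr1, cpow_one, cpow_one]
  ring

/-! ### Polar decomposition and the modular conjugation -/

namespace StandardSubspace

variable {H : Type*} [NormedAddCommGroup H] [InnerProductSpace ℂ H] [CompleteSpace H]
  (V : StandardSubspace H)

/-- The operator `B ^ a (1 - B) ^ b`, where `B = (1 + Δ)⁻¹`. -/
noncomputable abbrev modPow (a b : ℂ) : H →L[ℂ] H := opPowProd V.meanProj a b

theorem modPow_modPow {a b c d : ℂ} (ha : RegularExponent a) (hb : RegularExponent b)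
    (hc : RegularExponent c) (hd : RegularExponent d) (v : H) :
    V.modPow a b (V.modPow c d v) = V.modPow (a + c) (b + d) v :=
  opPowProd_apply_apply V.meanProj_nonneg V.meanProj_le_one ha hb hc hd v

theorem modPow_one_zero (v : H) : V.modPow 1 0 v = V.meanProj v := by
  rw [modPow, opPowProd_one_zero V.meanProj_nonneg]

theorem modPow_zero_one (v : H) : V.modPow 0 1 v = v - V.meanProj v := by
  rw [modPow, opPowProd_zero_one V.meanProj_nonneg]; rfl

theorem modPow_one_one (v : H) : V.modPow 1 1 v = V.diffProj (V.diffProj v) := by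
  rw [modPow, opPowProd_one_one V.meanProj_nonneg V.meanProj_le_one, diffProj_diffProj,
    mul_apply_eq_comp]
  exact map_sub _ _ _

theorem modPow_zero_one_injective : Function.Injective (V.modPow 0 1) := by
  intro v w h
  rw [modPow_zero_one, modPow_zero_one] at h
  exact V.sub_meanProj_injective h

theorem modPow_one_zero_injective : Function.Injective (V.modPow 1 0) := by
  intro v w h
  rw [modPow_one_zero, modPow_one_zero] at h
  exact V.meanProj_injective h

theorem regularExponent_one : RegularExponent 1 := .of_pos (by simp)

theorem regularExponent_half : RegularExponent (1 / 2) := .of_pos (by norm_num)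

theorem modPow_one_one_injective : Function.Injective (V.modPow 1 1) := by
  intro v w h
  have key : ∀ v, V.modPow 1 1 v = V.modPow 1 0 (V.modPow 0 1 v) := fun v => by
    rw [modPow_modPow V regularExponent_one .zero .zero regularExponent_one, add_zero, zero_add]
  rw [key, key] at h
  exact V.modPow_zero_one_injective (V.modPow_one_zero_injective h)

theorem modPow_half_half_twice (v : H) :
    V.modPow (1 / 2) (1 / 2) (V.modPow (1 / 2) (1 / 2) v) = V.modPow 1 1 v := by
  rw [modPow_modPow V regularExponent_half regularExponent_half regularExponent_half
    regularExponent_half]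
  norm_num

theorem inner_modPow_ofReal (a b : ℝ) (v w : H) :
    inner ℂ (V.modPow a b v) w = inner ℂ v (V.modPow a b w) :=
  inner_opPowProd_ofReal V.meanProj_nonneg V.meanProj_le_one a b v w

theorem inner_modPow_half_half (v w : H) :
    inner ℂ (V.modPow (1 / 2) (1 / 2) v) w = inner ℂ v (V.modPow (1 / 2) (1 / 2) w) := by
  have := V.inner_modPow_ofReal (1 / 2) (1 / 2) v w
  push_cast at this
  exact this

theorem denseRange_modPow_half_half : DenseRange (V.modPow (1 / 2) (1 / 2)) := by
  refine denseRange_of_symmetric_injective V.inner_modPow_half_half fun v w h => ?_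
  apply V.modPow_one_one_injective
  rw [← modPow_half_half_twice, ← modPow_half_half_twice, h]

theorem denseRange_modPow_one_one : DenseRange (V.modPow 1 1) := by
  refine denseRange_of_symmetric_injective (fun v w => ?_) V.modPow_one_one_injective
  have := V.inner_modPow_ofReal 1 1 v w
  push_cast at this
  exact this

theorem diffProj_modPow {a b : ℝ} (ha : 0 ≤ a) (hb : 0 ≤ b) (v : H) :
    V.diffProj (V.modPow a b v) = V.modPow b a (V.diffProj v) :=
  antilinear_opPowProd V.meanProj_nonneg V.meanProj_le_one V.diffProj_meanProj ha hb v

theorem diffProj_modPow_half_half (v : H) :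
    V.diffProj (V.modPow (1 / 2) (1 / 2) v) = V.modPow (1 / 2) (1 / 2) (V.diffProj v) := by
  have := V.diffProj_modPow (a := 1 / 2) (b := 1 / 2) (by norm_num) (by norm_num) v
  push_cast at this
  exact this

/-- By the symmetry `inner_diffProj`, both squares are the quadratic form of `D² = B(1 - B)`. Hence
`polarConj` is well defined and isometric. -/
theorem norm_diffProj (v : H) : ‖V.diffProj v‖ = ‖V.modPow (1 / 2) (1 / 2) v‖ := by
  have h : ‖V.diffProj v‖ ^ 2 = ‖V.modPow (1 / 2) (1 / 2) v‖ ^ 2 := by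
    rw [← re_inner_self, ← re_inner_self, inner_diffProj, inner_modPow_half_half,
      modPow_half_half_twice, modPow_one_one, ← inner_conj_symm, conj_re]
  exact (pow_left_inj₀ (norm_nonneg _) (norm_nonneg _) two_ne_zero).1 h

/-- The antilinear part in the polar decomposition of the difference of the real projections. -/
noncomputable def polarConj : H →L⋆[ℂ] H :=
  V.diffProj.toLinearMap.extendOfNorm (V.modPow (1 / 2) (1 / 2)).toLinearMap

theorem polarConj_modPow_half_half (v : H) :
    V.polarConj (V.modPow (1 / 2) (1 / 2) v) = V.diffProj v :=
  LinearMap.extendOfNorm_eq (f := V.diffProj.toLinearMap)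
    (e := (V.modPow (1 / 2) (1 / 2)).toLinearMap) V.denseRange_modPow_half_half
    ⟨1, fun x => by rw [one_mul]; exact (V.norm_diffProj x).le⟩ v

theorem polarConj_polarConj (v : H) : V.polarConj (V.polarConj v) = v := by
  refine V.denseRange_modPow_one_one.induction_on (p := fun v => V.polarConj (V.polarConj v) = v) v
    (isClosed_eq (by fun_prop) continuous_id) fun u => ?_
  rw [← modPow_half_half_twice, polarConj_modPow_half_half, diffProj_modPow_half_half,
    polarConj_modPow_half_half, ← modPow_one_one, modPow_half_half_twice]

/-- Inherited from `D` on the dense range of `(B(1 - B))^(1/2)`; this is the bounded form of `JΔJ =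
Δ⁻¹`. -/
theorem polarConj_modPow {a b : ℝ} (ha : 0 ≤ a) (hb : 0 ≤ b) (v : H) :
    V.polarConj (V.modPow a b v) = V.modPow b a (V.polarConj v) := by
  refine V.denseRange_modPow_half_half.induction_on
    (p := fun v => V.polarConj (V.modPow a b v) = V.modPow b a (V.polarConj v)) v
    (isClosed_eq (by fun_prop) (by fun_prop)) fun u => ?_
  rw [modPow_modPow V (.ofReal ha) (.ofReal hb) regularExponent_half regularExponent_half,
    add_comm (a : ℂ), add_comm (b : ℂ), ← modPow_modPow V regularExponent_half
    regularExponent_half (.ofReal ha) (.ofReal hb), polarConj_modPow_half_half,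
    polarConj_modPow_half_half, diffProj_modPow V ha hb]

/-- In `Dξ = (1 - B)ξ` the left side is `J (B(1 - B))^(1/2) ξ` and the right side is `JBJξ`; cancel
`J`. -/
theorem mem_iff_modPow_half_half_eq {ξ : H} : ξ ∈ V.toClosedSubmodule.toSubmodule ↔
    V.modPow (1 / 2) (1 / 2) ξ = V.modPow 1 0 (V.polarConj ξ) := by
  have h1 : V.polarConj (V.modPow 1 0 (V.polarConj ξ)) = ξ - V.meanProj ξ := by
    have := V.polarConj_modPow (a := 1) (b := 0) zero_le_one le_rfl (V.polarConj ξ)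
    push_cast at this
    rw [this, polarConj_polarConj, modPow_zero_one]
  rw [mem_iff_diffProj_eq, ← polarConj_modPow_half_half, ← h1]
  refine ⟨fun h => ?_, fun h => by rw [h]⟩
  rw [← V.polarConj_polarConj (V.modPow (1 / 2) (1 / 2) ξ), h, polarConj_polarConj]

/-- For `|Re z| < 1`, the relation `Δ ^ z ξ = ζ` in terms of bounded operators. -/
theorem exists_operatorPower_eq_iff {z : ℂ} (hz : |z.re| < 1) {ξ ζ : H} :
    (∃ h : ξ ∈ (operatorPower V.modularOperator z).domain,
      ζ = operatorPower V.modularOperator z ⟨ξ, h⟩) ↔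
    V.modPow (1 - z) (1 + z) ξ = V.modPow 1 1 ζ := by
  -- For `|Re z| < 1` the regularizer is the first power `B(1 - B)`.
  have hfl : ⌊|z.re|⌋₊ + 1 = 1 := by rw [Nat.floor_eq_zero.2 hz]
  have hcfc : cfc (regularizedPower 1 z) V.meanProj = V.modPow (1 - z) (1 + z) := by
    refine cfc_congr fun x hx => ?_
    obtain ⟨r, hr0, hr1, rfl⟩ := exists_real_of_mem_spectrum V.meanProj_nonneg V.meanProj_le_one hx
    exact regularizedPower_one_eq_powProd hz hr0 hr1
  set g := LinearMap.ker
    (((cfc (regularizedPower (⌊|z.re|⌋₊ + 1) z) (oneAddInv V.modularOperator) : H →L[ℂ] H) :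
        H →ₗ[ℂ] H) ∘ₗ LinearMap.fst ℂ H H -
      (((oneAddInv V.modularOperator * (1 - oneAddInv V.modularOperator)) ^
        (⌊|z.re|⌋₊ + 1) : H →L[ℂ] H) : H →ₗ[ℂ] H) ∘ₗ LinearMap.snd ℂ H H) with hg
  have hmem : ∀ p : H × H, p ∈ g ↔ V.modPow (1 - z) (1 + z) p.1 = V.modPow 1 1 p.2 := by
    intro p
    rw [hg, LinearMap.mem_ker, hfl, oneAddInv_modularOperator, hcfc, pow_one,
      ← opPowProd_one_one V.meanProj_nonneg V.meanProj_le_one]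
    exact sub_eq_zero
  have hsv : ∀ p ∈ g, p.1 = 0 → p.2 = 0 := by
    intro p hp h0
    rw [hmem, h0, map_zero] at hp
    exact V.modPow_one_one_injective (hp.symm.trans (map_zero _).symm)
  have hgr := Submodule.toLinearPMap_graph_eq g hsv
  rw [← hmem (ξ, ζ), ← hgr, LinearPMap.mem_graph_iff]
  constructor
  · rintro ⟨h, rfl⟩
    exact ⟨⟨ξ, h⟩, rfl, rfl⟩
  · rintro ⟨⟨y, hy⟩, rfl, rfl⟩
    exact ⟨hy, rfl⟩

/-- At `z = 1/2` the regularized equation carries a superfluous injective factor `1 - B`. -/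
theorem exists_operatorPower_half_eq_iff {ξ ζ : H} :
    (∃ h : ξ ∈ (operatorPower V.modularOperator (1 / 2)).domain,
      ζ = operatorPower V.modularOperator (1 / 2) ⟨ξ, h⟩) ↔
    V.modPow (1 / 2) (1 / 2) ξ = V.modPow 1 0 ζ := by
  rw [exists_operatorPower_eq_iff V (by norm_num [abs_lt])]
  have h1 : V.modPow (1 - 1 / 2) (1 + 1 / 2) ξ =
      V.modPow 0 1 (V.modPow (1 / 2) (1 / 2) ξ) := by
    rw [modPow_modPow V .zero regularExponent_one regularExponent_half regularExponent_half]
    norm_num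
  have h2 : V.modPow 1 1 ζ = V.modPow 0 1 (V.modPow 1 0 ζ) := by
    rw [modPow_modPow V .zero regularExponent_one regularExponent_one .zero]
    norm_num
  rw [h1, h2]
  exact V.modPow_zero_one_injective.eq_iff

theorem modPow_half_half_eq_of_mem_tomitaDomain (x : V.tomitaDomain) :
    V.modPow (1 / 2) (1 / 2) (x : H) = V.modPow 1 0 (V.polarConj (V.tomita x)) := by
  obtain ⟨x, hx⟩ := x
  obtain ⟨p, hp, q, hq, h⟩ := id hx
  rw [V.tomita_apply_of_eq hx hp hq h]
  change V.modPow (1 / 2) (1 / 2) x = _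
  rw [h, map_add, map_smul, V.mem_iff_modPow_half_half_eq.1 hp, V.mem_iff_modPow_half_half_eq.1 hq,
    map_sub, map_smulₛₗ V.polarConj, conj_I, map_sub, map_smul, neg_smul, sub_neg_eq_add]

/-- On `D(T)` one has `Δ^(1/2) x = J T x` with `J = polarConj`, hence `J Δ^(1/2) x = T x`. The
common domain contains the range of `B`, and `Δ^(1/2) B = (B(1 - B))^(1/2)` has dense range, so the
extension is unique. -/
theorem modularConjugation_eq : V.modularConjugation = V.polarConj := by
  have he : ∀ x : (V.tomitaDomain ⊓ (operatorPower V.modularOperator (1 / 2)).domain :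
      Submodule ℂ H), ((operatorPower V.modularOperator (1 / 2)).toFun ∘ₗ
        (Submodule.inclusion inf_le_right)) x =
      V.polarConj (V.tomita (Submodule.inclusion inf_le_left x)) := by
    intro x
    obtain ⟨h, h'⟩ := V.exists_operatorPower_half_eq_iff.2
      (V.modPow_half_half_eq_of_mem_tomitaDomain (Submodule.inclusion inf_le_left x))
    exact h'.symm
  refine LinearMap.extendOfNorm_unique ?_ ‖V.polarConj‖ ?_ _ ?_
  · refine V.denseRange_modPow_half_half.mono ?_
    rintro _ ⟨v, rfl⟩
    obtain ⟨h, h'⟩ := V.exists_operatorPower_half_eq_iff (ξ := V.meanProj v)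
      (ζ := V.modPow (1 / 2) (1 / 2) v) |>.2 (by
        rw [← modPow_one_zero, modPow_modPow V regularExponent_half regularExponent_half
          regularExponent_one .zero, modPow_modPow V regularExponent_one .zero
          regularExponent_half regularExponent_half, add_comm, add_comm (1 / 2 : ℂ) 0])
    exact ⟨⟨V.meanProj v, V.meanProj_mem_tomitaDomain v, h⟩, h'.symm⟩
  · intro x
    rw [he]
    refine le_trans ?_ (V.polarConj.le_opNorm _)
    rw [polarConj_polarConj]
    exact le_rfl
  · ext x
    rw [LinearMap.comp_apply, he]
    exact V.polarConj_polarConj _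

/-! ### Bounded powers on the closed strip `0 ≤ Re w ≤ 1/2` -/

/-- The operator `B ^ (1/2 - w) (1 - B) ^ w = B ^ (1/2) Δ ^ w` for `0 ≤ Re w ≤ 1/2`. -/
noncomputable def stripOp (w : ℂ) : H →L[ℂ] H :=
  (V.modPow (3 / 2 - w) (1 + w)).toLinearMap.extendOfNorm (V.modPow 1 1).toLinearMap

/-- On the edges of the strip `x^(1/2 - w) (1 - x)^w` may oscillate at an endpoint of `[0, 1]`,
outside the continuous calculus. The extra factor `x(1 - x)` raises both exponents to real part at
least `1`; this bound lets it be divided out again. -/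
theorem norm_modPow_strip_le {w : ℂ} (hw0 : 0 ≤ w.re) (hw1 : w.re ≤ 1 / 2) (v : H) :
    ‖V.modPow (3 / 2 - w) (1 + w) v‖ ≤ 1 * ‖V.modPow 1 1 v‖ := by
  rw [one_mul]
  refine norm_opPowProd_apply_le V.meanProj_nonneg V.meanProj_le_one ?_ ?_ v
  · have : (3 / 2 : ℂ).re = 3 / 2 := by norm_num
    rw [sub_re, this]; linarith
  · rw [add_re, one_re]; linarith

theorem stripOp_modPow_one_one {w : ℂ} (hw0 : 0 ≤ w.re) (hw1 : w.re ≤ 1 / 2) (v : H) :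
    V.stripOp w (V.modPow 1 1 v) = V.modPow (3 / 2 - w) (1 + w) v :=
  LinearMap.extendOfNorm_eq (f := (V.modPow (3 / 2 - w) (1 + w)).toLinearMap)
    (e := (V.modPow 1 1).toLinearMap) V.denseRange_modPow_one_one
    ⟨1, V.norm_modPow_strip_le hw0 hw1⟩ v

theorem norm_stripOp_apply_le {w : ℂ} (hw0 : 0 ≤ w.re) (hw1 : w.re ≤ 1 / 2) (u : H) :
    ‖V.stripOp w u‖ ≤ ‖u‖ := by
  have := LinearMap.norm_extendOfNorm_apply_le (f := (V.modPow (3 / 2 - w) (1 + w)).toLinearMap)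
    (e := (V.modPow 1 1).toLinearMap) V.denseRange_modPow_one_one
    1 (V.norm_modPow_strip_le hw0 hw1) u
  rwa [one_mul] at this

theorem regularExponent_of_strip {w : ℂ} (hw0 : 0 ≤ w.re) (hw1 : w.re ≤ 1 / 2) :
    RegularExponent (3 / 2 - w) ∧ RegularExponent (1 + w) := by
  have : (3 / 2 : ℂ).re = 3 / 2 := by norm_num
  constructor <;> apply RegularExponent.of_pos
  · rw [sub_re, this]; linarith
  · rw [add_re, one_re]; linarith

theorem stripOp_eq_modPow {w : ℂ} (hw0 : 0 ≤ w.re) (hw1 : w.re ≤ 1 / 2)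
    (ha : RegularExponent (1 / 2 - w)) (hb : RegularExponent w) (u : H) :
    V.stripOp w u = V.modPow (1 / 2 - w) w u := by
  refine V.denseRange_modPow_one_one.induction_on
    (p := fun u => V.stripOp w u = V.modPow (1 / 2 - w) w u) u
    (isClosed_eq (by fun_prop) (by fun_prop)) fun v => ?_
  rw [stripOp_modPow_one_one V hw0 hw1, modPow_modPow V ha hb regularExponent_one
    regularExponent_one]
  congr 2 <;> ring

/-- The regularized form of `Δ^s (B^(1/2) Δ^w u) = B^(1/2) Δ^(w + s) u` for imaginary `s`. -/
theorem modPow_stripOp {w s : ℂ} (hw0 : 0 ≤ w.re) (hw1 : w.re ≤ 1 / 2) (hs : s.re = 0) (u : H) :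
    V.modPow (1 - s) (1 + s) (V.stripOp w u) = V.modPow 1 1 (V.stripOp (w + s) u) := by
  have hre : (w + s).re = w.re := by rw [add_re, hs, add_zero]
  obtain ⟨h1, h2⟩ := regularExponent_of_strip hw0 hw1
  obtain ⟨h3, h4⟩ := regularExponent_of_strip (hre.symm ▸ hw0) (hre.symm ▸ hw1)
  refine V.denseRange_modPow_one_one.induction_on
    (p := fun u => V.modPow (1 - s) (1 + s) (V.stripOp w u) = V.modPow 1 1 (V.stripOp (w + s) u)) u
    (isClosed_eq (by fun_prop) (by fun_prop)) fun v => ?_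
  rw [stripOp_modPow_one_one V hw0 hw1, stripOp_modPow_one_one V (hre.symm ▸ hw0) (hre.symm ▸ hw1),
    modPow_modPow V (.of_pos (by simp [hs])) (.of_pos (by simp [hs])) h1 h2,
    modPow_modPow V regularExponent_one regularExponent_one h3 h4]
  congr 2 <;> ring

theorem differentiableOn_modPow_apply (a b : ℂ) (v : H) :
    DifferentiableOn ℂ (fun w => V.modPow (a - w) (b + w) v) {w | -b.re < w.re ∧ w.re < a.re} :=
  (differentiableOn_opPowProd V.meanProj_nonneg V.meanProj_le_one a b).clm_apply
    (differentiableOn_const v)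

/-- The contraction bound does not depend on `w`, so approximating `u` from the range of `B(1 - B)`
is uniform on the strip; continuity and holomorphy pass to the limit. -/
theorem exists_tendstoUniformlyOn_stripOp (u : H) : ∃ v : ℕ → H,
    TendstoUniformlyOn (fun n w => V.modPow (3 / 2 - w) (1 + w) (v n)) (fun w => V.stripOp w u)
      Filter.atTop {w | 0 ≤ w.re ∧ w.re ≤ 1 / 2} := by
  obtain ⟨x, hx, hxu⟩ := mem_closure_iff_seq_limit.1 (V.denseRange_modPow_one_one u)
  choose v hv using hx
  refine ⟨v, Metric.tendstoUniformlyOn_iff.2 fun ε hε => ?_⟩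
  filter_upwards [Metric.tendsto_nhds.1 hxu ε hε] with n hn w hw
  rw [← stripOp_modPow_one_one V hw.1 hw.2, hv, dist_eq_norm, ← map_sub]
  refine (V.norm_stripOp_apply_le hw.1 hw.2 _).trans_lt ?_
  rwa [← dist_eq_norm, dist_comm]

theorem strip_subset : {w : ℂ | 0 ≤ w.re ∧ w.re ≤ 1 / 2} ⊆
    {w : ℂ | -(1 : ℂ).re < w.re ∧ w.re < (3 / 2 : ℂ).re} := by
  rintro w ⟨h1, h2⟩
  have : (3 / 2 : ℂ).re = 3 / 2 := by norm_num
  refine ⟨?_, ?_⟩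
  · rw [one_re]; linarith
  · rw [this]; linarith

theorem continuousOn_stripOp (u : H) :
    ContinuousOn (fun w => V.stripOp w u) {w | 0 ≤ w.re ∧ w.re ≤ 1 / 2} := by
  obtain ⟨v, hv⟩ := V.exists_tendstoUniformlyOn_stripOp u
  exact hv.continuousOn (Filter.Frequently.of_forall fun n =>
    ((V.differentiableOn_modPow_apply (3 / 2) 1 (v n)).mono strip_subset).continuousOn)

theorem differentiableOn_stripOp (u : H) :
    DifferentiableOn ℂ (fun w => V.stripOp w u) {w | 0 < w.re ∧ w.re < 1 / 2} := by
  obtain ⟨v, hv⟩ := V.exists_tendstoUniformlyOn_stripOp u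
  have hsub : {w : ℂ | 0 < w.re ∧ w.re < 1 / 2} ⊆ {w : ℂ | 0 ≤ w.re ∧ w.re ≤ 1 / 2} :=
    fun w hw => ⟨hw.1.le, hw.2.le⟩
  exact (hv.mono hsub).tendstoLocallyUniformlyOn.differentiableOn
    (.of_forall fun n =>
      (V.differentiableOn_modPow_apply (3 / 2) 1 (v n)).mono (hsub.trans strip_subset))
    ((isOpen_lt continuous_const continuous_re).inter (isOpen_lt continuous_re continuous_const))

end StandardSubspace

/-! ### Orbit maps on strips and the four conditions -/

namespace StandardSubspace

variable {H : Type*} [NormedAddCommGroup H] [InnerProductSpace ℂ H] [CompleteSpace H]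
  (V : StandardSubspace H)

theorem re_orbit_exponent (z : ℂ) : (-(I * z) / (2 * Real.pi)).re = z.im / (2 * Real.pi) := by
  have h : -(I * z) / (2 * Real.pi) = (-(I * z)) / ((2 * Real.pi : ℝ) : ℂ) := by push_cast; rfl
  rw [h, div_ofReal_re]
  simp

theorem re_orbit_exponent_ofReal (t : ℝ) : (-(I * (t : ℂ)) / (2 * Real.pi)).re = 0 := by
  rw [re_orbit_exponent, ofReal_im, zero_div]

/-- The exponent has real part `w₀ + Im z / 2π`. Condition (iii) uses `w₀ = 0`, condition (iv) `w₀ =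
1/4`; both sweep out exactly `0 ≤ Re w ≤ 1/2`. -/
theorem isOrbitExtension_stripOp {w₀ a b : ℝ} (ha : a ≤ 0) (hb : 0 ≤ b)
    (ha' : 0 ≤ w₀ + a / (2 * Real.pi)) (hb' : w₀ + b / (2 * Real.pi) ≤ 1 / 2) (u : H) :
    IsOrbitExtension V.modularOperator (V.stripOp w₀ u) a b
      (fun z => V.stripOp (w₀ + -(I * z) / (2 * Real.pi)) u) := by
  have hre : ∀ z : ℂ, (w₀ + -(I * z) / (2 * Real.pi) : ℂ).re = w₀ + z.im / (2 * Real.pi) :=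
    fun z => by rw [add_re, re_orbit_exponent, ofReal_re]
  have hpi := Real.two_pi_pos
  refine ⟨(V.continuousOn_stripOp u).comp (by fun_prop) ?_,
    (V.differentiableOn_stripOp u).comp (by fun_prop) ?_, fun t => ?_⟩
  · rintro z ⟨h1, h2⟩
    simp only [Set.mem_ofPred_eq, hre]
    have h3 : a / (2 * Real.pi) ≤ z.im / (2 * Real.pi) := by gcongr
    have h4 : z.im / (2 * Real.pi) ≤ b / (2 * Real.pi) := by gcongr
    constructor <;> linarith
  · rintro z ⟨h1, h2⟩
    simp only [Set.mem_ofPred_eq, hre]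
    have h3 : a / (2 * Real.pi) < z.im / (2 * Real.pi) := by gcongr
    have h4 : z.im / (2 * Real.pi) < b / (2 * Real.pi) := by gcongr
    constructor <;> linarith
  · have h3 : a / (2 * Real.pi) ≤ 0 := div_nonpos_of_nonpos_of_nonneg ha hpi.le
    have h4 : 0 ≤ b / (2 * Real.pi) := div_nonneg hb hpi.le
    rw [exists_operatorPower_eq_iff V (by rw [re_orbit_exponent_ofReal]; simp)]
    exact V.modPow_stripOp (by rw [ofReal_re]; linarith) (by rw [ofReal_re]; linarith)
      (re_orbit_exponent_ofReal t) u

/-- An extension of an orbit map is given by the functional calculus. -/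
theorem modPow_one_one_orbitExtension {ξ : H} {a b : ℝ} {F : ℂ → H}
    (hF : IsOrbitExtension V.modularOperator ξ a b F) (ha : a ≤ 0) (hb : 0 ≤ b)
    (ha' : -(2 * Real.pi) < a) (hb' : b < 2 * Real.pi) {z : ℂ} (hz0 : a ≤ z.im) (hzb : z.im ≤ b) :
    V.modPow 1 1 (F z) =
      V.modPow (1 - -(I * z) / (2 * Real.pi)) (1 + -(I * z) / (2 * Real.pi)) ξ := by
  have hpi := Real.two_pi_pos
  have hgd : DifferentiableOn ℂ
      (fun z : ℂ => V.modPow (1 - -(I * z) / (2 * Real.pi)) (1 + -(I * z) / (2 * Real.pi)) ξ)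
      {z | a ≤ z.im ∧ z.im ≤ b} := by
    refine (V.differentiableOn_modPow_apply 1 1 ξ).comp
      (f := fun z : ℂ => -(I * z) / (2 * Real.pi)) (by fun_prop) ?_
    rintro w ⟨h1, h2⟩
    simp only [Set.mem_ofPred_eq, re_orbit_exponent, one_re]
    constructor
    · rw [lt_div_iff₀ hpi]; linarith
    · rw [div_lt_iff₀ hpi]; linarith
  have hreal : ∀ t : ℝ, V.modPow 1 1 (F t) =
      V.modPow (1 - -(I * (t : ℂ)) / (2 * Real.pi)) (1 + -(I * (t : ℂ)) / (2 * Real.pi)) ξ :=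
    fun t => ((V.exists_operatorPower_eq_iff (by rw [re_orbit_exponent_ofReal]; simp)).1
      (hF.eq_orbit t)).symm
  have hfc : ContinuousOn (fun z => V.modPow 1 1 (F z)) {z | a ≤ z.im ∧ z.im ≤ b} :=
    (V.modPow 1 1).continuous.comp_continuousOn hF.continuousOn
  have hfd : DifferentiableOn ℂ (fun z => V.modPow 1 1 (F z)) {z | a < z.im ∧ z.im < b} :=
    (V.modPow 1 1).differentiable.comp_differentiableOn hF.differentiableOn
  -- The parts above and below the real line are treated separately, since the line itself may bound
  -- the strip.
  rcases lt_trichotomy z.im 0 with h | h | h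
  · have hs : {z : ℂ | a ≤ z.im ∧ z.im ≤ 0} ⊆ {z | a ≤ z.im ∧ z.im ≤ b} :=
      fun w hw => ⟨hw.1, hw.2.trans hb⟩
    refine eq_on_lower_strip_of_eq_on_real (b := -a) (f := fun z => V.modPow 1 1 (F z))
      (g := fun z : ℂ => V.modPow (1 - -(I * z) / (2 * Real.pi)) (1 + -(I * z) / (2 * Real.pi)) ξ)
      (by linarith) ?_ ?_ ?_ ?_ hreal (by rwa [neg_neg]) h.le <;> rw [neg_neg]
    · exact hfc.mono hs
    · exact hfd.mono fun w hw => ⟨hw.1, hw.2.trans_le hb⟩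
    · exact hgd.continuousOn.mono hs
    · exact hgd.mono fun w hw => ⟨hw.1.le, hw.2.le.trans hb⟩
  · have : z = (z.re : ℂ) := Complex.ext rfl (by simpa using h)
    rw [this]
    exact hreal _
  · have hs : {z : ℂ | 0 ≤ z.im ∧ z.im ≤ b} ⊆ {z | a ≤ z.im ∧ z.im ≤ b} :=
      fun w hw => ⟨ha.trans hw.1, hw.2⟩
    exact eq_on_strip_of_eq_on_real (f := fun z => V.modPow 1 1 (F z))
      (g := fun z : ℂ => V.modPow (1 - -(I * z) / (2 * Real.pi)) (1 + -(I * z) / (2 * Real.pi)) ξ)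
      (by linarith) (hfc.mono hs) (hfd.mono fun w hw => ⟨ha.trans_lt hw.1, hw.2⟩)
      (hgd.continuousOn.mono hs) (hgd.mono fun w hw => ⟨ha.trans hw.1.le, hw.2.le⟩) hreal h.le hzb

theorem polarConj_modPow_half_zero (v : H) :
    V.polarConj (V.modPow (1 / 2) 0 v) = V.modPow 0 (1 / 2) (V.polarConj v) := by
  have := V.polarConj_modPow (a := 1 / 2) (b := 0) (by norm_num) le_rfl v
  push_cast at this
  exact this

/-- A standard subspace is the image under `(1 + Δ) ^ (-1/2)` of the fixed vectors of `J`. -/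
theorem exists_fixed_of_mem {ξ : H} (hξ : ξ ∈ V.toClosedSubmodule.toSubmodule) :
    ∃ u : H, V.polarConj u = u ∧ V.modPow (1 / 2) 0 u = ξ := by
  have hh := regularExponent_half
  have h1 : V.polarConj (V.modPow 0 (1 / 2) (V.polarConj ξ)) = V.modPow (1 / 2) 0 ξ := by
    have := V.polarConj_modPow (a := 0) (b := 1 / 2) le_rfl (by norm_num) (V.polarConj ξ)
    push_cast at this
    rw [this, polarConj_polarConj]
  -- With `u = B^(1/2) ξ + (1 - B)^(1/2) Jξ`, `J` exchanges the summands, and `B^(1/2) u = Bξ + (B(1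
  -- - B))^(1/2) Jξ = Bξ + (1 - B)ξ`.
  refine ⟨V.modPow (1 / 2) 0 ξ + V.modPow 0 (1 / 2) (V.polarConj ξ), ?_, ?_⟩
  · rw [map_add, polarConj_modPow_half_zero, h1, add_comm]
  · have h2 : V.modPow (1 / 2) (1 / 2) (V.polarConj ξ) = ξ - V.meanProj ξ := by
      rw [← V.mem_iff_diffProj_eq.1 hξ, ← V.polarConj_modPow_half_half]
      have := V.polarConj_modPow (a := 1 / 2) (b := 1 / 2) (by norm_num) (by norm_num) ξ
      push_cast at this
      exact this.symm
    rw [map_add, modPow_modPow V hh .zero hh .zero, modPow_modPow V hh .zero .zero hh, add_zero,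
      add_zero, zero_add, add_halves, modPow_one_zero, h2]
    abel

/-- For `ξ = B^(1/2) u` with `Ju = u`, the value at `πi` is `(1 - B)^(1/2) u = J B^(1/2) u`. -/
theorem exists_orbitExtension_of_mem {ξ : H} (hξ : ξ ∈ V.toClosedSubmodule.toSubmodule) :
    ∃ F : ℂ → H, IsOrbitExtension V.modularOperator ξ 0 Real.pi F ∧
      F (Real.pi * I) = V.polarConj ξ := by
  obtain ⟨u, hu, rfl⟩ := V.exists_fixed_of_mem hξ
  have hpi : (Real.pi : ℂ) ≠ 0 := ofReal_ne_zero.2 Real.pi_ne_zero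
  have hF := V.isOrbitExtension_stripOp (w₀ := 0) (a := 0) (b := Real.pi) le_rfl Real.pi_pos.le
    (by simp) (by have := Real.pi_pos; rw [zero_add, div_le_iff₀ (by positivity)]; linarith) u
  rw [ofReal_zero, stripOp_eq_modPow V (by simp) (by simp)
    (by rw [sub_zero]; exact regularExponent_half) .zero, sub_zero] at hF
  refine ⟨_, hF, ?_⟩
  have h1 : (0 : ℂ) + -(I * (Real.pi * I)) / (2 * Real.pi) = 1 / 2 := by
    field_simp
    rw [I_sq]; ring
  rw [h1, stripOp_eq_modPow V (by norm_num) (by norm_num) (by rw [sub_self]; exact .zero)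
    regularExponent_half, sub_self, polarConj_modPow_half_zero, hu]

theorem mem_of_orbitExtension {ξ : H} {F : ℂ → H}
    (hF : IsOrbitExtension V.modularOperator ξ 0 Real.pi F)
    (hFpi : F (Real.pi * I) = V.polarConj ξ) : ξ ∈ V.toClosedSubmodule.toSubmodule := by
  have hpi : (Real.pi : ℂ) ≠ 0 := ofReal_ne_zero.2 Real.pi_ne_zero
  have hpi0 := Real.pi_pos
  have h := V.modPow_one_one_orbitExtension hF le_rfl hpi0.le (by linarith) (by linarith)
    (z := Real.pi * I) (by simp [hpi0.le]) (by simp)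
  have h1 : -(I * (Real.pi * I)) / (2 * Real.pi) = (1 / 2 : ℂ) := by
    field_simp
    rw [I_sq]; ring
  rw [h1, hFpi] at h
  obtain ⟨hd, hζ⟩ := (V.exists_operatorPower_eq_iff (z := 1 / 2) (by norm_num [abs_lt])).2 h.symm
  exact V.mem_iff_modPow_half_half_eq.2 (V.exists_operatorPower_half_eq_iff.1 ⟨hd, hζ⟩)

/-- The vector `η = Δ^(1/4) ξ = (B(1 - B))^(1/4) u` is fixed by `J` because its two exponents agree.
-/
theorem exists_symmetric_orbitExtension_of_mem {ξ : H}
    (hξ : ξ ∈ V.toClosedSubmodule.toSubmodule) : ∃ η : H, V.polarConj η = η ∧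
      ∃ F : ℂ → H, IsOrbitExtension V.modularOperator η (-(Real.pi / 2)) (Real.pi / 2) F ∧
        F (-(Real.pi * I / 2)) = ξ := by
  obtain ⟨u, hu, rfl⟩ := V.exists_fixed_of_mem hξ
  have hpi : (Real.pi : ℂ) ≠ 0 := ofReal_ne_zero.2 Real.pi_ne_zero
  have hpi0 := Real.pi_pos
  have hq : RegularExponent (1 / 4) := .of_pos (by norm_num)
  have hE : V.stripOp (1 / 4 : ℝ) u = V.modPow (1 / 4 : ℝ) (1 / 4 : ℝ) u := by
    rw [stripOp_eq_modPow V (by rw [ofReal_re]; norm_num) (by rw [ofReal_re]; norm_num) ?_ ?_]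
    · congr 2; push_cast; norm_num
    · push_cast; norm_num; exact hq
    · push_cast; exact hq
  have hquot : Real.pi / 2 / (2 * Real.pi) = 1 / 4 := by field_simp; norm_num
  refine ⟨V.stripOp (1 / 4 : ℝ) u, ?_, _,
    V.isOrbitExtension_stripOp (w₀ := 1 / 4) (by linarith) (by linarith)
      (by rw [neg_div, hquot]; norm_num) (by rw [hquot]; norm_num) u, ?_⟩
  · rw [hE, polarConj_modPow V (by norm_num) (by norm_num), hu]
  · have h1 : ((1 / 4 : ℝ) : ℂ) + -(I * -(Real.pi * I / 2)) / (2 * Real.pi) = 0 := by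
      push_cast
      field_simp
      rw [I_sq]; ring
    simp only [h1]
    rw [stripOp_eq_modPow V (by simp) (by simp) (by rw [sub_zero]; exact regularExponent_half) .zero,
      sub_zero]

theorem mem_of_symmetric_orbitExtension {ξ η : H} (hη : V.polarConj η = η) {F : ℂ → H}
    (hF : IsOrbitExtension V.modularOperator η (-(Real.pi / 2)) (Real.pi / 2) F)
    (hFξ : F (-(Real.pi * I / 2)) = ξ) : ξ ∈ V.toClosedSubmodule.toSubmodule := by
  have hpi : (Real.pi : ℂ) ≠ 0 := ofReal_ne_zero.2 Real.pi_ne_zero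
  have hpi0 := Real.pi_pos
  have him : (-(Real.pi * I / 2) : ℂ).im = -(Real.pi / 2) := by simp
  have h := V.modPow_one_one_orbitExtension hF (by linarith) (by linarith) (by linarith)
    (by linarith) (z := -(Real.pi * I / 2)) him.ge (by rw [him]; linarith)
  have h1 : -(I * -(Real.pi * I / 2)) / (2 * Real.pi) = (-(1 / 4) : ℂ) := by
    field_simp
    rw [I_sq]; ring
  have h2 : (1 - -(1 / 4) : ℂ) = 5 / 4 := by norm_num
  have h3 : (1 + -(1 / 4) : ℂ) = 3 / 4 := by norm_num
  rw [h1, h2, h3, hFξ] at h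
  have h54 : RegularExponent (5 / 4) := .of_pos (by norm_num)
  have h34 : RegularExponent (3 / 4) := .of_pos (by norm_num)
  have hh := regularExponent_half
  have ho := regularExponent_one
  -- Here `h` reads `B(1 - B)ξ = B^(5/4) (1 - B)^(3/4) η`, and `J` swaps the exponents. After
  -- multiplication by `B(1 - B)`, both sides of the criterion for `V` become `B^(7/4) (1 - B)^(5/4)
  -- η`.
  have hJ : V.modPow 1 1 (V.polarConj ξ) = V.modPow (3 / 4) (5 / 4) η := by
    have e1 := V.polarConj_modPow (a := 1) (b := 1) zero_le_one zero_le_one ξ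
    have e2 := V.polarConj_modPow (a := 5 / 4) (b := 3 / 4) (by norm_num) (by norm_num) η
    push_cast at e1 e2
    rw [← e1, h, e2, hη]
  rw [mem_iff_modPow_half_half_eq]
  apply V.modPow_one_one_injective
  rw [modPow_modPow V ho ho hh hh, modPow_modPow V ho ho ho .zero, add_comm 1 (1 / 2 : ℂ),
    ← modPow_modPow V hh hh ho ho, h, add_comm (1 : ℂ) 0, ← modPow_modPow V ho .zero ho ho, hJ,
    modPow_modPow V hh hh h54 h34, modPow_modPow V ho .zero h34 h54]
  norm_num

end StandardSubspace

theorem proposition2p1 {H : Type*} [NormedAddCommGroup H] [InnerProductSpace ℂ H]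
    [CompleteSpace H] (V : StandardSubspace H) (ξ : H) :
    List.TFAE [
      ξ ∈ V.toClosedSubmodule,
      ∃ h : ξ ∈ (operatorPower V.modularOperator (1 / 2)).domain,
        operatorPower V.modularOperator (1 / 2) ⟨ξ, h⟩ = V.modularConjugation ξ,
      ∃ F : ℂ → H, IsOrbitExtension V.modularOperator ξ 0 Real.pi F ∧
        F (Real.pi * I) = V.modularConjugation ξ,
      ∃ η : H, V.modularConjugation η = η ∧
        ∃ F : ℂ → H, IsOrbitExtension V.modularOperator η (-(Real.pi / 2)) (Real.pi / 2) F ∧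
          F (-(Real.pi * I / 2)) = ξ] := by

  rw [V.modularConjugation_eq]
  tfae_have 1 ↔ 2 := by
    have h1 : ξ ∈ V.toClosedSubmodule ↔
        V.modPow (1 / 2) (1 / 2) ξ = V.modPow 1 0 (V.polarConj ξ) := V.mem_iff_modPow_half_half_eq
    rw [h1, ← V.exists_operatorPower_half_eq_iff]
    exact exists_congr fun _ => eq_comm
  tfae_have 1 → 3 := fun h => V.exists_orbitExtension_of_mem h
  tfae_have 3 → 1 := fun ⟨_, hF, h⟩ => V.mem_of_orbitExtension hF h
  tfae_have 1 → 4 := fun h => V.exists_symmetric_orbitExtension_of_mem h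
  tfae_have 4 → 1 := fun ⟨_, hη, _, hF, h⟩ => V.mem_of_symmetric_orbitExtension hη hF h
  tfae_finish
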